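/- Let $K$ be a field and let $K_0(\mathcal V_K)$ be the Grothendieck ring of varieties over $K$ (separated schemes of finite type over $K$): it is the free abelian group on isomorphism classes of varieties, with product induced by $X\times_K Y$, modulo the relations $[X]=[Z]+[X\smallsetminus Z]$ for $Z\subseteq X$ closed. Put $\mathbb T=[\mathbb A^1\smallsetminus\mathbb A^0]$. For a finite connected multigraph $G$ with edge set $E$, let $\Psi_G=\sum_{S}\prod_{e\notin S}t_e\in K[t_e: e\in E]$, the sum running over the (edge sets of) spanning trees $S$ of $G$, and let $\mathbb U(G)=[\mathbb A^{E}\smallsetminus\{\Psi_G=0\}]\in K_0(\mathcal V_K)$. An $m$-banana consists of $m$ parallel edges joining two vertices. A melonic construction is a list of tuples $((a_1,\dots,a_r),p,k)$ with $r\ge 1$ and all $a_i\ge 1$; starting from a single edge (regarded as the first banana constructed at stage $0$), the $s$-th tuple ($s\ge1$) replaces one edge of the $k$-th banana constructed at stage $p$ by a string consisting of an $a_1$-banana, …, an $a_r$-banana; these are the bananas constructed at stage $s$. For $n\ge 2$ the vacuum chain $\Gamma'_n$ of $n$ circles is the graph determined up to isomorphism by the melonic construction $$((4),0,1),\ ((1,3,1),1,1),\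 ((1,3,1),2,2),\ \dots,\ ((1,3,1),n-2,2),$$ so that $\Gamma'_2$ is the $4$-banana, and for $n\ge 3$ there are $n-2$ tuples with first entry $(1,3,1)$. Define polynomials $A_n(t),A'_n(t)\in\mathbb Z[t]$, $n\ge0$, as follows. Write $$e^{rs}\cos\big((r^2-rt)^{1/2}s\big)=\sum_{k\ge0}a_k(r,t)\frac{s^k}{k!},\qquad \cos\Big(\frac{(r^2-rt)^{1/2}}{1-r}\,s\Big)=\sum_{k\ge0}a'_k(r,t)\frac{s^k}{k!},$$ where $a_k,a'_k$ are regarded as power series in $r$ over $\mathbb Z[t]$, and let $$\sum_{k\ge0}a_k(r,t)=\sum_{n\ge0}A_n(t)r^n,\qquad \sum_{k\ge0}a'_k(r,t)=\sum_{n\ge0}A'_n(t)r^n$$ as formal power series in $r$. Then $A_n$ and $A'_n$ are well defined. The polynomials $A'_n$ are equivalently determined by $$\sum_{n\ge0}A'_n(t)r^n=\frac{(1-r)^2}{1-(2+t)r+2r^2},$$ and $A'_n(t)=A_n(t)-A_{n-1}(t)$ for all $n\ge1$. For every $n\ge2$, the graph $\Gamma'_n$ exists and $$\mathbb U(\Gamma'_n)=\mathbb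 T^{\,n-1}(\mathbb T+1)^{2n-3}\,A'_n(\mathbb T)\quad\text{in }K_0(\mathcal V_K).$$ -/

import Mathlib

open CategoryTheory AlgebraicGeometry MonoidalCategory
open scoped Graph PowerSeries Polynomial

universe u

noncomputable section

/-! ### The Grothendieck ring of varieties -/

/-- Separated schemes of finite type over the field `K`, as a property of `K`-schemes. -/
def IsVariety (K : Type u) [Field K] : ObjectProperty (Over (Spec (.of K))) := fun X =>
  LocallyOfFiniteType X.hom ∧ QuasiCompact X.hom ∧ IsSeparated X.hom

/-- `Spec K` is a variety, and varieties are stable under the fibre product over `K`. -/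
instance (K : Type u) [Field K] : (IsVariety K).IsMonoidal where
  prop_unit := by
    refine ⟨?_, ?_, ?_⟩ <;> simp <;> infer_instance
  prop_tensor X Y := by
    rintro ⟨_, _, _⟩ ⟨_, _, _⟩
    refine ⟨?_, ?_, ?_⟩ <;> rw [Over.tensorObj_hom] <;> infer_instance

/-- The category of varieties over `K`, with the fibre product over `K` as tensor product. -/
abbrev Variety (K : Type u) [Field K] := (IsVariety K).FullSubcategory

/-- The free abelian group on the isomorphism classes of varieties over `K`. It is a commutative
ring, with multiplication induced by the product of varieties. -/
abbrev FreeVarietyRing (K : Type u) [Field K] := FreeAbelianGroup (Skeleton (Variety K))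

/-- The generator given by the isomorphism class of the variety `X`. -/
def FreeVarietyRing.of {K : Type u} [Field K] (X : Variety K) : FreeVarietyRing K :=
  FreeAbelianGroup.of (toSkeleton X)

/-- The inclusion-exclusion relations `[X] - ([Z] + [X ∖ Z])`, where `Z` is a closed subvariety of
`X` and `X ∖ Z` its open complement. -/
def scissorRelations (K : Type u) [Field K] : Set (FreeVarietyRing K) :=
  {x | ∃ (X Z U : Variety K) (i : Z ⟶ X) (j : U ⟶ X),
    IsClosedImmersion i.hom.left ∧ IsOpenImmersion j.hom.left ∧
    Set.range j.hom.left = (Set.range i.hom.left)ᶜ ∧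
    x = FreeVarietyRing.of X - (FreeVarietyRing.of Z + FreeVarietyRing.of U)}

/-- The Grothendieck ring `K₀` of varieties over `K`. -/
abbrev GrothendieckRing (K : Type u) [Field K] :=
  FreeVarietyRing K ⧸ Ideal.span (scissorRelations K)

/-- The class `[X]` of a variety in the Grothendieck ring. -/
def varietyClass {K : Type u} [Field K] (X : Variety K) : GrothendieckRing K :=
  Ideal.Quotient.mk _ (FreeVarietyRing.of X)

/-- The complement of the hypersurface `f = 0` in the affine space over `K` with coordinates
indexed by the finite type `ι`. -/
def hypersurfaceComplement {K : Type u} [Field K] {ι : Type} [Finite ι] (f : MvPolynomial ι K) :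
    Variety K where
  obj := Over.mk
    ((show (Spec (.of (MvPolynomial ι K))).Opens from PrimeSpectrum.basicOpen f).ι ≫
      Spec.map (CommRingCat.ofHom (MvPolynomial.C : K →+* MvPolynomial ι K)))
  property := by
    have hft : LocallyOfFiniteType
        (Spec.map (CommRingCat.ofHom (MvPolynomial.C : K →+* MvPolynomial ι K))) := by
      rw [HasRingHomProperty.Spec_iff (P := @LocallyOfFiniteType)]
      exact (RingHom.finiteType_algebraMap (A := K) (B := MvPolynomial ι K)).2 inferInstance
    have hN : IsLocallyNoetherian (Spec (.of (MvPolynomial ι K))) := inferInstance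
    let U : (Spec (.of (MvPolynomial ι K))).Opens := PrimeSpectrum.basicOpen f
    let g := Spec.map (CommRingCat.ofHom (MvPolynomial.C : K →+* MvPolynomial ι K))
    have h₁ : LocallyOfFiniteType (U.ι ≫ g) := inferInstance
    have h₂ : QuasiCompact (U.ι ≫ g) := inferInstance
    have h₃ : IsSeparated (U.ι ≫ g) := inferInstance
    exact ⟨h₁, h₂, h₃⟩

/-- The class `𝕋 = [𝔸¹ ∖ 𝔸⁰]` of the torus. -/
def torusClass (K : Type u) [Field K] : GrothendieckRing K :=
  varietyClass (hypersurfaceComplement (MvPolynomial.X () : MvPolynomial Unit K))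

/-! ### Graph hypersurfaces -/

namespace Graph

variable {α β : Type}

/-- The vertices `x` and `y` are joined by a path whose edges all belong to `T`. -/
def JoinedBy (G : Graph α β) (T : Set E(G)) (x y : α) : Prop :=
  Relation.ReflTransGen (fun v w => ∃ e ∈ T, G.IsLink e v w) x y

/-- The edges in `T` form a spanning tree: they connect all the vertices, and they contain no
cycle, i.e. the ends of any `e ∈ T` are not joined by the other edges in `T`. -/
def IsSpanningTree (G : Graph α β) (T : Set E(G)) : Prop :=
  (∀ x ∈ V(G), ∀ y ∈ V(G), G.JoinedBy T x y) ∧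
    ∀ e ∈ T, ∀ x y, G.IsLink e x y → ¬ G.JoinedBy (T \ {e}) x y

open scoped Classical in
/-- The Kirchhoff--Symanzik polynomial: the sum over the spanning trees `T` of the product of the
variables of the edges that are not in `T`. -/
def kirchhoffPolynomial (K : Type u) [Field K] (G : Graph α β) [Fintype E(G)] :
    MvPolynomial E(G) K :=
  ∑ T ∈ (Finset.univ : Finset (Finset E(G))).filter (fun T => G.IsSpanningTree {e | e ∈ T}),
    ∏ e ∈ Finset.univ \ T, MvPolynomial.X e

/-- The class `𝕌(G)` of the complement of the affine graph hypersurface in the affine space with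
coordinates indexed by the edges. -/
def grothendieckClass (K : Type u) [Field K] (G : Graph α β) [Fintype E(G)] :
    GrothendieckRing K :=
  varietyClass (hypersurfaceComplement (G.kirchhoffPolynomial K))

/-- Isomorphism of multigraphs. -/
def IsIsomorphic {α' β' : Type} (G : Graph α β) (H : Graph α' β') : Prop :=
  ∃ (φ : V(G) ≃ V(H)) (ψ : E(G) ≃ E(H)), ∀ (e : E(G)) (x y : V(G)),
    G.IsLink e x y ↔ H.IsLink (ψ e) (φ x) (φ y)

end Graph

/-! ### Melonic graphs -/

/-- A multigraph with directed edges. The directions are only used to fix the order in which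
strings of bananas are inserted. -/
structure DirectedMultigraph (V E : Type) where
  src : E → V
  tgt : E → V

namespace DirectedMultigraph

variable {V E : Type}

/-- The underlying undirected multigraph. -/
def toGraph (G : DirectedMultigraph V E) : Graph V E where
  vertexSet := Set.univ
  edgeSet := Set.univ
  IsLink e x y := (G.src e = x ∧ G.tgt e = y) ∨ (G.src e = y ∧ G.tgt e = x)
  isLink_symm _ _ := ⟨fun _ _ h => h.symm⟩
  eq_or_eq_of_isLink_of_isLink := by grind
  edge_mem_iff_exists_isLink e := by simpa using ⟨_, _, Or.inl ⟨rfl, rfl⟩⟩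
  left_mem_of_isLink := by simp

/-- A single edge with two distinct ends. -/
def singleEdge : DirectedMultigraph Bool Unit where
  src _ := false
  tgt _ := true

/-- The `i`-th vertex on a string of `r` bananas that replaces the edge `e`: the `0`-th one is the
source of `e`, the `r`-th one is the target of `e`, and the `r - 1` vertices between them are
new. -/
def stringVertex (G : DirectedMultigraph V E) (e : E) (r i : ℕ) : V ⊕ Fin (r - 1) :=
  if i = 0 then .inl (G.src e)
  else if h : i - 1 < r - 1 then .inr ⟨i - 1, h⟩
  else .inl (G.tgt e)

/-- The bananification of the edge `e`: it is replaced by a string consisting of an `a₁`-banana, ...,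
an `aᵣ`-banana, where `b = [a₁, ..., aᵣ]`. -/
def bananify (G : DirectedMultigraph V E) (e : E) (b : List ℕ) :
    DirectedMultigraph (V ⊕ Fin (b.length - 1))
      ({f : E // f ≠ e} ⊕ (Σ i : Fin b.length, Fin (b.get i))) where
  src := Sum.elim (fun f => .inl (G.src f)) (fun f => G.stringVertex e b.length f.1)
  tgt := Sum.elim (fun f => .inl (G.tgt f)) (fun f => G.stringVertex e b.length (f.1 + 1))

end DirectedMultigraph

/-- One tuple `((a₁, ..., aᵣ), p, k)` of a melonic construction: replace one edge of the `k`-th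
banana constructed at stage `p` by a string of bananas of sizes `a₁, ..., aᵣ`. -/
structure MelonicStep where
  sizes : List ℕ
  stage : ℕ
  index : ℕ

/-- The graph `H` is obtained (up to isomorphism) from `G` by performing the given steps. The label
`(p, k)` of an edge of `G` records that it lies in the `k`-th banana constructed at stage `p`, and
`s` is the number of the next stage. -/
def IsConstructedFrom {α β : Type} (H : Graph α β) :
    List MelonicStep → ∀ {V E : Type}, DirectedMultigraph V E → (E → ℕ × ℕ) → ℕ → Prop
  | [], _, _, G, _, _ => G.toGraph.IsIsomorphic H
  | t :: T, _, E, G, label, s =>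
    t.sizes ≠ [] ∧ (∀ a ∈ t.sizes, 0 < a) ∧
      ∃ e : E, label e = (t.stage, t.index) ∧
        IsConstructedFrom H T (G.bananify e t.sizes)
          (Sum.elim (fun f => label f) (fun f => (s, (f.1 : ℕ) + 1))) (s + 1)

/-- `H` is a melonic graph determined by the melonic construction `T`, which is applied to a single
edge, regarded as the first banana at stage `0`. -/
def IsMelonicGraph {α β : Type} (T : List MelonicStep) (H : Graph α β) : Prop :=
  IsConstructedFrom H T DirectedMultigraph.singleEdge (fun _ => (0, 1)) 1

/-- The melonic construction of the vacuum chain `Γ'ₙ` of `n ≥ 2` circles: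
`((4), 0, 1), ((1,3,1), 1, 1), ((1,3,1), 2, 2), ..., ((1,3,1), n - 2, 2)`. -/
def vacuumChain (n : ℕ) : List MelonicStep :=
  ⟨[4], 0, 1⟩ ::
    (List.range (n - 2)).map fun i => ⟨[1, 3, 1], i + 1, if i = 0 then 1 else 2⟩

/-! ### Expansions of `e^{rs} cos(τ s)` and `cos(τ s / (1 - r))`, where `τ² = r² - r t` -/

/-- The ring `ℚ[t]⟦r⟧[τ]` with `τ² = r² - r t`. The variable `t` is the variable of `ℚ[X]`, and
`r` is the variable of the power series over it. -/
abbrev TauRing : Type :=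
  AdjoinRoot (Polynomial.X ^ 2 - Polynomial.C
    (PowerSeries.X ^ 2 - PowerSeries.X * PowerSeries.C Polynomial.X : ℚ[X]⟦X⟧))

namespace TauRing

/-- The inclusion of `ℚ[t]⟦r⟧`. -/
def ofSeries : ℚ[X]⟦X⟧ →+* TauRing := AdjoinRoot.of _

/-- The natural map from `ℤ[t]⟦r⟧`. -/
def ofIntSeries : ℤ[X]⟦X⟧ →+* TauRing :=
  ofSeries.comp (PowerSeries.map (Polynomial.mapRingHom (Int.castRingHom ℚ)))

/-- The square root `τ = (r² - r t)^{1/2}`. -/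
def tau : TauRing := AdjoinRoot.root _

/-- The power series `e^{rs} cos(τ s)` in `s`. -/
def expCosSeries : TauRing⟦X⟧ :=
  PowerSeries.rescale (ofSeries PowerSeries.X) (PowerSeries.exp TauRing) *
    PowerSeries.rescale tau (PowerSeries.cos TauRing)

/-- The power series `cos((τ / (1 - r)) s)` in `s`. -/
def cosSeries : TauRing⟦X⟧ :=
  PowerSeries.rescale (tau * ofSeries (PowerSeries.invOfUnit (1 - PowerSeries.X) 1))
    (PowerSeries.cos TauRing)

/-- If `F = ∑ₖ aₖ(r, t) sᵏ / k!`, then `∑ₖ aₖ(r, t) = ∑ₙ Pₙ(t) rⁿ` as formal power series in `r`: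
for each `n`, only finitely many `aₖ` contribute to the coefficient of `rⁿ`, and these
contributions add up to `Pₙ`. -/
def IsSummedExpansion (F : TauRing⟦X⟧) (P : ℕ → ℤ[X]) : Prop :=
  ∃ a : ℕ → ℤ[X]⟦X⟧, F = PowerSeries.mk (fun k => ((Nat.factorial k : ℚ)⁻¹) • ofIntSeries (a k)) ∧
    ∀ n, {k | PowerSeries.coeff n (a k) ≠ 0}.Finite ∧ ∑ᶠ k, PowerSeries.coeff n (a k) = P n

end TauRing

end

/-! For an edge `e` write `Ψ = t F + H`, with `t` the variable of `e` and `F`, `H` the polynomials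
of the deletion and the contraction of `e` (`edgePair`). Over `F ≠ 0` the locus `Ψ ≠ 0` is a line
minus a point, over `F = 0, H ≠ 0` it is a whole line, and elsewhere it is empty. So the class of `Ψ
≠ 0` is `𝕋 α + (𝕋 + 1) z`, where `α`, `z` are the classes of these two strata; together with the
class `x` of `F H ≠ 0` they form `HasStrata`.

Splitting `e` in series or doubling it changes `(F, H)` by `seriesPair` or `parallelPair`, and the
triple `(α, x, z)` changes linearly (`HasStrata.series`, `HasStrata.parallel`). A `4`-banana is
three doublings of a bridge. A string of `1`, `3` and `1` edges is two splittings followed by two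
doublings; a splitting forgets the old `x`, so each such step is a 2×2 linear map on `(α, z)`
(`strataStep`). That these operations describe the actual graphs follows from the classification of
spanning trees after a bananification (`isTree_joinEdges_iff`, `treePolynomial_bananify`).

The map has trace `𝕋 (𝕋 + 1)² (𝕋 + 2)` and determinant `2 𝕋² (𝕋 + 1)⁴`. By Cayley–Hamilton, the
classes divided formally by `𝕋ⁿ⁻¹ (𝕋 + 1)²ⁿ⁻³` obey `Pₙ₊₂ = (2 + t) Pₙ₊₁ - 2 Pₙ`, the recurrence
with denominator `1 - (2 + t) r + 2 r²` (`strataStep_iterate_eq`).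

On the analytic side, `e^{as} cos(bs)` solves a second-order linear equation, so its coefficients
`aₖ` satisfy a two-term recurrence (`coeff_exp_mul_cos`). Telescoping sums them to a rational
function of `r` (`recurrentSum_mul`). For both expansions the denominator is the one above, with
numerators `1 - r` and `(1 - r)²`. -/

noncomputable section

/-! ### Classes of affine varieties -/

section AffineClass

variable (K : Type u) [Field K]

/-- The affine variety `Spec R` of a finitely generated `K`-algebra `R`. -/
def affineVariety (R : Type u) [CommRing R] [Algebra K R] [Algebra.FiniteType K R] : Variety K where
  obj := Over.mk (Spec.map (CommRingCat.ofHom (algebraMap K R)))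
  property := by
    have hft : LocallyOfFiniteType (Spec.map (CommRingCat.ofHom (algebraMap K R))) := by
      rw [HasRingHomProperty.Spec_iff (P := @LocallyOfFiniteType)]
      exact (RingHom.finiteType_algebraMap (A := K) (B := R)).2 inferInstance
    exact ⟨hft, inferInstanceAs (QuasiCompact (Spec.map _)),
      inferInstanceAs (IsSeparated (Spec.map _))⟩

/-- The class `[Spec R]` of a finitely generated `K`-algebra `R`. -/
def affineClass (R : Type u) [CommRing R] [Algebra K R] [Algebra.FiniteType K R] :
    GrothendieckRing K :=
  varietyClass (affineVariety K R)

variable {K}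

theorem varietyClass_eq_of_iso {X Y : Variety K} (e : X ≅ Y) :
    varietyClass X = varietyClass Y := by
  rw [varietyClass, varietyClass, FreeVarietyRing.of, FreeVarietyRing.of,
    congr_toSkeleton_of_iso e]

theorem varietyClass_tensor (X Y : Variety K) :
    varietyClass (X ⊗ Y) = varietyClass X * varietyClass Y := by
  simp only [varietyClass, FreeVarietyRing.of, Skeleton.toSkeleton_tensorObj, ← map_mul]
  rw [FreeAbelianGroup.of_mul_of]

theorem varietyClass_unit : varietyClass (𝟙_ (Variety K)) = 1 := by
  rw [varietyClass, FreeVarietyRing.of, ← Skeleton.one_eq, ← FreeAbelianGroup.one_def, map_one]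

theorem varietyClass_eq_add {X Z U : Variety K} (i : Z ⟶ X) (j : U ⟶ X)
    (hi : IsClosedImmersion i.hom.left) (hj : IsOpenImmersion j.hom.left)
    (h : Set.range j.hom.left = (Set.range i.hom.left)ᶜ) :
    varietyClass X = varietyClass Z + varietyClass U := by
  rw [varietyClass, varietyClass, varietyClass, ← map_add, Ideal.Quotient.mk_eq_mk_iff_sub_mem]
  exact Ideal.subset_span ⟨X, Z, U, i, j, hi, hj, h, rfl⟩

variable {R S : Type u} [CommRing R] [CommRing S] [Algebra K R] [Algebra K S]
  [Algebra.FiniteType K R] [Algebra.FiniteType K S]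

variable (K) in
theorem affineClass_congr (e : R ≃ₐ[K] S) : affineClass K R = affineClass K S := by
  refine varietyClass_eq_of_iso (ObjectProperty.isoMk _ (Over.isoMk
    (Scheme.Spec.mapIso e.toRingEquiv.toCommRingCatIso.symm.op) ?_))
  simp only [affineVariety, Functor.mapIso_hom, Iso.op_hom, Scheme.Spec_map, Over.mk_hom]
  rw [← Spec.map_comp]
  congr 1
  ext x
  exact e.symm.commutes x

variable (K) in
theorem affineClass_tensorProduct [Algebra.FiniteType K (TensorProduct K R S)] :
    affineClass K (TensorProduct K R S) = affineClass K R * affineClass K S := by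
  rw [affineClass, affineClass, affineClass, ← varietyClass_tensor]
  refine varietyClass_eq_of_iso (ObjectProperty.isoMk _ (Over.isoMk
    (pullbackSpecIso K R S).symm ?_))
  change (pullbackSpecIso K R S).inv ≫ Limits.pullback.fst _ _ ≫
    Spec.map (CommRingCat.ofHom (algebraMap K R)) = _
  rw [pullbackSpecIso_inv_fst_assoc, ← Spec.map_comp]
  rfl

variable (K) in
theorem affineClass_self : affineClass K K = 1 := by
  rw [← varietyClass_unit]
  refine varietyClass_eq_of_iso (ObjectProperty.isoMk _ (Over.isoMk (Iso.refl _) ?_))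
  simp [affineVariety]

/-- The morphism of affine varieties given by a homomorphism of algebras. -/
def affineVarietyMap (φ : R →ₐ[K] S) : affineVariety K S ⟶ affineVariety K R :=
  ObjectProperty.homMk (Over.homMk (Spec.map (CommRingCat.ofHom φ.toRingHom)) (by
    simp only [affineVariety, Over.mk_hom]
    rw [← Spec.map_comp, ← CommRingCat.ofHom_comp]
    congr 2
    exact φ.comp_algebraMap))

/-- The scissor relation for a principal closed subset. -/
theorem affineClass_eq_add {R' : Type u} [CommRing R'] [Algebra K R'] [Algebra.FiniteType K R']
    (φ : R →ₐ[K] R') (hφ : Function.Surjective φ) (g : R)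
    (hg : RingHom.ker φ = Ideal.span {g}) [Algebra R S] [IsScalarTower K R S]
    [IsLocalization.Away g S] :
    affineClass K R = affineClass K R' + affineClass K S := by
  refine varietyClass_eq_add (affineVarietyMap φ)
    (affineVarietyMap (IsScalarTower.toAlgHom K R S)) ?_ ?_ ?_
  · exact IsClosedImmersion.spec_of_surjective _ hφ
  · exact IsOpenImmersion.of_isLocalization (R := R) (S := S) g
  · change Set.range (PrimeSpectrum.comap (algebraMap R S)) =
      (Set.range (PrimeSpectrum.comap φ.toRingHom))ᶜ
    rw [PrimeSpectrum.localization_away_comap_range S g,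
      range_comap_of_surjective _ φ.toRingHom hφ,
      show RingHom.ker φ.toRingHom = Ideal.span {g} from hg, PrimeSpectrum.zeroLocus_span,
      PrimeSpectrum.basicOpen_eq_zeroLocus_compl]


variable (K) in
/-- The class of the open subset `f ≠ 0` of `Spec R`. -/
def principalClass (f : R) : GrothendieckRing K := affineClass K (Localization.Away f)

theorem principalClass_eq_affineClass (f : R) [Algebra R S] [IsScalarTower K R S]
    [IsLocalization.Away f S] : principalClass K f = affineClass K S :=
  affineClass_congr K ((IsLocalization.algEquiv (Submonoid.powers f) (Localization.Away f)
    S).restrictScalars K)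

theorem principalClass_one : principalClass K (1 : R) = affineClass K R :=
  have := IsLocalization.away_of_isUnit_of_bijective R isUnit_one
    Function.bijective_id
  principalClass_eq_affineClass (1 : R)

theorem principalClass_congr (e : R ≃ₐ[K] S) (f : R) :
    principalClass K (e f) = principalClass K f := by
  refine affineClass_congr K (IsLocalization.algEquivOfAlgEquiv (M := .powers (e f))
    (T := .powers f) _ _ e.symm ?_)
  simp

theorem principalClass_mul_of_away (g f : R) [Algebra R S] [IsScalarTower K R S]
    [IsLocalization.Away g S] :
    principalClass K (g * f) = principalClass K (algebraMap R S f) :=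
  principalClass_eq_affineClass _

/-- The scissor relation for a principal closed subset of `f ≠ 0`. -/
theorem principalClass_eq_add {R' : Type u} [CommRing R'] [Algebra K R'] [Algebra.FiniteType K R']
    (φ : R →ₐ[K] R') (hφ : Function.Surjective φ) (g : R)
    (hg : RingHom.ker φ = Ideal.span {g}) (f : R) :
    principalClass K f = principalClass K (f * g) + principalClass K (φ f) := by
  have hsurj := IsLocalization.Away.mapₐ_surjective_of_surjective
    (Aₚ := Localization.Away f) (Bₚ := Localization.Away (φ f)) f hφ
  have hker : RingHom.ker (IsLocalization.Away.mapₐ (Localization.Away f)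
      (Localization.Away (φ f)) φ f) =
      Ideal.span {algebraMap R (Localization.Away f) g} := by
    have := IsLocalization.ker_map (S := Localization.Away f) (Localization.Away (φ f))
      (g := φ.toRingHom) (Submonoid.map_powers φ.toRingHom f)
    rw [show RingHom.ker φ.toRingHom = Ideal.span {g} from hg, Ideal.map_span,
      Set.image_singleton] at this
    exact this
  rw [principalClass, affineClass_eq_add _ hsurj _ hker
    (S := Localization.Away (algebraMap R (Localization.Away f) g)), add_comm]
  congr 1
  exact (principalClass_eq_affineClass _).symm

/-- The scissor relation for the closed subset cut out by `0`, which is everything, reads `c = c +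
c`. -/
theorem principalClass_zero : principalClass K (0 : R) = 0 := by
  have := principalClass_eq_add (AlgHom.id K R) Function.surjective_id 0
    (by ext; simp) 0
  simpa using this

/-- The locus `g f ≠ 0` does not meet `g = 0`, so the closed part of the scissor relation along `g`
is empty. -/
theorem principalClass_mul_self (g f : R) :
    principalClass K (g * f * g) = principalClass K (g * f) := by
  have := principalClass_eq_add (Ideal.Quotient.mkₐ K (Ideal.span {g}))
    (Ideal.Quotient.mkₐ_surjective K _) g (Ideal.Quotient.mkₐ_ker K _) (g * f)
  have h : Ideal.Quotient.mkₐ K (Ideal.span {g}) (g * f) = 0 :=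
    Ideal.Quotient.eq_zero_iff_mem.2 (Ideal.mul_mem_right _ _ (Ideal.mem_span_singleton_self g))
  rw [h, principalClass_zero, add_zero] at this
  exact this.symm


theorem affineClass_polynomial_eq_mul :
    affineClass K R[X] = affineClass K R * affineClass K K[X] := by
  have : Algebra.FiniteType K (TensorProduct K R K[X]) := .equiv inferInstance (polyEquivTensor K R)
  rw [← affineClass_tensorProduct]
  exact affineClass_congr K (polyEquivTensor K R)

theorem ker_aeval_zero :
    RingHom.ker (Polynomial.aeval (0 : R) : R[X] →ₐ[R] R) = Ideal.span {Polynomial.X} := by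
  ext p
  rw [RingHom.mem_ker, Ideal.mem_span_singleton, Polynomial.X_dvd_iff,
    Polynomial.coeff_zero_eq_aeval_zero]

/-- The open subset `t f ≠ 0` of the open subset `f ≠ 0` of `𝔸¹ × Spec R`. -/
theorem principalClass_X_mul (f : R[X]) :
    principalClass K (Polynomial.X * f) = principalClass K f - principalClass K (f.eval 0) := by
  have := principalClass_eq_add (K := K)
    ((Polynomial.aeval (0 : R) : R[X] →ₐ[R] R).restrictScalars K) (fun r => ⟨Polynomial.C r, by simp⟩)
    Polynomial.X ker_aeval_zero f
  rw [eq_sub_iff_add_eq, mul_comm, this]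
  simp [Polynomial.aeval_def, Polynomial.eval]

theorem varietyClass_hypersurfaceComplement {ι : Type} [Finite ι] (f : MvPolynomial ι K) :
    varietyClass (hypersurfaceComplement f) = principalClass K f := by
  refine varietyClass_eq_of_iso (ObjectProperty.isoMk _ (Over.isoMk
    (basicOpenIsoSpecAway (R := .of (MvPolynomial ι K)) f) ?_))
  have h : Spec.map (CommRingCat.ofHom (algebraMap K (Localization.Away f))) =
      Spec.map (CommRingCat.ofHom (algebraMap (MvPolynomial ι K) (Localization.Away f))) ≫
        Spec.map (CommRingCat.ofHom (MvPolynomial.C : K →+* MvPolynomial ι K)) := by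
    rw [← Spec.map_comp]
    rfl
  change (basicOpenIsoSpecAway (R := .of (MvPolynomial ι K)) f).hom ≫
    Spec.map (CommRingCat.ofHom (algebraMap K (Localization.Away f))) = _
  rw [h]
  exact basicOpenIsoSpecAway_hom_SpecMap_assoc (R := .of (MvPolynomial ι K)) f _

theorem torusClass_eq : torusClass K = principalClass K (Polynomial.X : K[X]) := by
  rw [torusClass, varietyClass_hypersurfaceComplement,
    ← principalClass_congr ((MvPolynomial.uniqueAlgEquiv K Unit))]
  simp

theorem affineClass_polynomial_self : affineClass K K[X] = torusClass K + 1 := by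
  have := principalClass_X_mul (K := K) (R := K) 1
  rw [mul_one, ← torusClass_eq, Polynomial.eval_one, principalClass_one, principalClass_one,
    affineClass_self] at this
  rw [this, sub_add_cancel]

theorem affineClass_polynomial : affineClass K R[X] = (torusClass K + 1) * affineClass K R := by
  rw [affineClass_polynomial_eq_mul, affineClass_polynomial_self, mul_comm]

theorem principalClass_X : principalClass K (Polynomial.X : R[X]) =
    torusClass K * affineClass K R := by
  have := principalClass_X_mul (K := K) (R := R) 1
  rw [mul_one, Polynomial.eval_one, principalClass_one, principalClass_one,
    affineClass_polynomial] at this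
  rw [this]
  ring

/-- If `a` is a unit, then `a t + b ≠ 0` defines a trivial torus bundle. -/
theorem principalClass_linear_of_isUnit (a b : R) (ha : IsUnit a) :
    principalClass K (Polynomial.C a * Polynomial.X + Polynomial.C b) =
      torusClass K * affineClass K R := by
  have := ha.invertible
  rw [← principalClass_X, ← principalClass_congr
    ((Polynomial.algEquivCMulXAddC a b).restrictScalars K) Polynomial.X]
  simp

theorem principalClass_C_mul (g : R) (f : R[X]) [Algebra R S] [IsScalarTower K R S]
    [IsLocalization.Away g S] : principalClass K (Polynomial.C g * f) =
      principalClass K (f.map (algebraMap R S)) := by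
  let _ : Algebra R[X] S[X] := Polynomial.algebra R S
  have : IsScalarTower K R[X] S[X] := .of_algebraMap_eq' (by
    ext; simp [Polynomial.algebraMap_def, IsScalarTower.algebraMap_apply K R S,
      Polynomial.algebraMap_apply])
  have : IsLocalization.Away (Polynomial.C g) S[X] := by
    have := Polynomial.isLocalization (.powers g) S
    rwa [Submonoid.map_powers] at this
  exact principalClass_mul_of_away _ _


theorem principalClass_C (f : R) :
    principalClass K (Polynomial.C f) = (torusClass K + 1) * principalClass K f := by
  have := principalClass_C_mul (K := K) (S := Localization.Away f) f 1
  rw [mul_one] at this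
  rw [this, Polynomial.map_one, principalClass_one, affineClass_polynomial, principalClass]

/-- Cut along `a = 0`. Where `a` is invertible the fibre is a line minus a point; where `a = 0` the
variable drops out and the fibre over `g b ≠ 0` is a line. -/
theorem principalClass_linear (g a b : R) :
    principalClass K (Polynomial.C g * (Polynomial.C a * Polynomial.X + Polynomial.C b)) =
      torusClass K * principalClass K (g * a) +
        (torusClass K + 1) * (principalClass K (g * b) - principalClass K (g * a * b)) := by
  let φ := Ideal.Quotient.mkₐ K (Ideal.span {a})
  have hφ : Function.Surjective φ := Ideal.Quotient.mkₐ_surjective K _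
  have hker : RingHom.ker φ = Ideal.span {a} := Ideal.Quotient.mkₐ_ker K _
  have hφa : φ a = 0 := Ideal.Quotient.eq_zero_iff_mem.2 (Ideal.mem_span_singleton_self a)
  have h := principalClass_eq_add (Polynomial.mapAlgHom φ) (Polynomial.map_surjective _ hφ)
    (Polynomial.C a) (by
      have := Polynomial.ker_mapRingHom φ.toRingHom
      rw [show RingHom.ker φ.toRingHom = Ideal.span {a} from hker, Ideal.map_span,
        Set.image_singleton] at this
      exact this)
    (Polynomial.C g * (Polynomial.C a * Polynomial.X + Polynomial.C b))
  have h₁ : Polynomial.C g * (Polynomial.C a * Polynomial.X + Polynomial.C b) * Polynomial.C a =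
      Polynomial.C (g * a) * (Polynomial.C a * Polynomial.X + Polynomial.C b) := by
    rw [Polynomial.C_mul]; ring
  have h₂ : Polynomial.mapAlgHom φ
      (Polynomial.C g * (Polynomial.C a * Polynomial.X + Polynomial.C b)) =
      Polynomial.C (φ (g * b)) := by
    simp [hφa]
  -- The stratum `a = 0, g b ≠ 0` is a difference of two principal open subsets of `Spec R`, so the
  -- quotient ring disappears from the answer.
  have h₃ := principalClass_eq_add φ hφ a hker (g * b)
  have h₄ : IsUnit (algebraMap R (Localization.Away (g * a)) a) :=
    isUnit_of_mul_isUnit_right (x := algebraMap R (Localization.Away (g * a)) g) (by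
      rw [← map_mul]; exact IsLocalization.Away.algebraMap_isUnit _)
  rw [h, h₁, h₂, principalClass_C,
    principalClass_C_mul (S := Localization.Away (g * a)), Polynomial.map_add, Polynomial.map_mul,
    Polynomial.map_C, Polynomial.map_X, Polynomial.map_C,
    principalClass_linear_of_isUnit _ _ h₄, ← principalClass, mul_right_comm g a b, h₃]
  ring


/-! ### Principal open subsets of affine spaces, with `none` as the extra coordinate -/

section MvPolynomial

open MvPolynomial

variable {σ τ : Type} [Finite σ] [Finite τ]

theorem principalClass_rename (e : σ ≃ τ) (f : MvPolynomial σ K) :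
    principalClass K (rename e f) = principalClass K f :=
  principalClass_congr (renameEquiv K e) f

omit [Finite σ] in
theorem optionEquivLeft_rename_some (p : MvPolynomial σ K) :
    optionEquivLeft K σ (rename some p) = Polynomial.C p := by
  induction p using MvPolynomial.induction_on with
  | C a => simp
  | add p q hp hq => simp [hp, hq]
  | mul_X p i hp => simp [hp]

theorem principalClass_option_linear (g a b : MvPolynomial σ K) :
    principalClass K (rename some g * (X none * rename some a + rename some b)) =
      torusClass K * principalClass K (g * a) +
        (torusClass K + 1) * (principalClass K (g * b) - principalClass K (g * a * b)) := by
  rw [← principalClass_linear, ← principalClass_congr (optionEquivLeft K σ)]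
  simp only [map_mul, map_add, optionEquivLeft_rename_some, optionEquivLeft_X_none,
    mul_comm Polynomial.X]

theorem principalClass_option_X_mul (f : MvPolynomial (Option σ) K) :
    principalClass K (X none * f) =
      principalClass K f - principalClass K (aeval (fun i => i.elim 0 X) f : MvPolynomial σ K) := by
  have h : (aeval (fun i => i.elim 0 X) f : MvPolynomial σ K) =
      (optionEquivLeft K σ f).eval 0 := by
    induction f using MvPolynomial.induction_on with
    | C a => simp
    | add p q hp hq => rw [map_add, map_add, Polynomial.eval_add, hp, hq]
    | mul_X p i hp =>
      rw [map_mul, map_mul, Polynomial.eval_mul, hp, aeval_X]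
      cases i <;> simp
  rw [h, ← principalClass_congr (optionEquivLeft K σ), ← principalClass_congr (optionEquivLeft K σ),
    map_mul, optionEquivLeft_X_none, principalClass_X_mul]

omit [Finite σ] in
theorem aeval_option_elim_rename_some (p : MvPolynomial σ K) :
    (aeval (fun i => i.elim 0 X) (rename some p) : MvPolynomial σ K) = p := by
  rw [aeval_rename]
  exact aeval_X_left_apply p

theorem principalClass_rename_some (p : MvPolynomial σ K) :
    principalClass K (rename some p) = (torusClass K + 1) * principalClass K p := by
  rw [← principalClass_C, ← optionEquivLeft_rename_some, principalClass_congr]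

end MvPolynomial

end AffineClass

/-! ### Pencils of hypersurfaces -/

section Pencil

open MvPolynomial

variable {K : Type u} [Field K] {σ τ : Type} [Finite σ] [Finite τ]

/-- The classes of `F ≠ 0`, of `F H ≠ 0` and of `F = 0, H ≠ 0` are `α`, `x` and `z`. -/
structure HasStrata (P : MvPolynomial σ K × MvPolynomial σ K) (α x z : GrothendieckRing K) :
    Prop where
  fst : principalClass K P.1 = α
  mul : principalClass K (P.1 * P.2) = x
  snd : principalClass K P.2 = x + z

/-- The effect on `Ψ = t F + H` of splitting the edge with variable `t` into two edges in series. -/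
def seriesPair (P : MvPolynomial σ K × MvPolynomial σ K) :
    MvPolynomial (Option σ) K × MvPolynomial (Option σ) K :=
  (rename some P.1, X none * rename some P.1 + rename some P.2)

/-- The effect on `Ψ = t F + H` of doubling the edge with variable `t`. -/
def parallelPair (P : MvPolynomial σ K × MvPolynomial σ K) :
    MvPolynomial (Option σ) K × MvPolynomial (Option σ) K :=
  (X none * rename some P.1 + rename some P.2, X none * rename some P.2)

theorem principalClass_self_mul {R : Type u} [CommRing R] [Algebra K R] [Algebra.FiniteType K R]
    (f : R) : principalClass K (f * f) = principalClass K f := by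
  simpa using principalClass_mul_self (K := K) f 1

variable {P : MvPolynomial σ K × MvPolynomial σ K} {α x z : GrothendieckRing K}

theorem HasStrata.rename (h : HasStrata P α x z) (e : σ ≃ τ) :
    HasStrata (rename e P.1, rename e P.2) α x z where
  fst := by rw [principalClass_rename, h.fst]
  mul := by rw [← map_mul, principalClass_rename, h.mul]
  snd := by rw [principalClass_rename, h.snd]

theorem principalClass_option_linear_one (a b : MvPolynomial σ K) :
    principalClass K (X none * MvPolynomial.rename some a + MvPolynomial.rename some b) =
      torusClass K * principalClass K a +
        (torusClass K + 1) * (principalClass K b - principalClass K (a * b)) := by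
  simpa using principalClass_option_linear (K := K) 1 a b

theorem HasStrata.linear (h : HasStrata P α x z) :
    principalClass K (X none * MvPolynomial.rename some P.1 + MvPolynomial.rename some P.2) =
      torusClass K * α + (torusClass K + 1) * z := by
  rw [principalClass_option_linear_one, h.fst, h.mul, h.snd]
  ring

/-- With `s` the new variable, `s F + H ≠ 0` is a punctured line over `F ≠ 0`, whatever `H` is;
hence the old `x` does not enter. Over `F = 0` the condition is `H ≠ 0`, with `s` free. -/
theorem HasStrata.series (h : HasStrata P α x z) :
    HasStrata (seriesPair P) ((torusClass K + 1) * α) (torusClass K * α)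
      ((torusClass K + 1) * z) where
  fst := by rw [seriesPair, principalClass_rename_some, h.fst]
  mul := by
    have : principalClass K (P.1 * P.1 * P.2) = principalClass K (P.1 * P.2) := by
      rw [mul_right_comm, principalClass_mul_self]
    rw [seriesPair, principalClass_option_linear, principalClass_self_mul, this, h.fst]
    ring
  snd := by
    rw [seriesPair, h.linear]

/-- With `s` the new variable, the new pair is `(s F + H, s H)`. Where `s F + H = 0` and `s H ≠ 0`,
both `F` and `H` are nonzero and `s = -H / F`, so this stratum is a copy of `F H ≠ 0`. The product
is nonzero on a line minus two points over `F H ≠ 0`, and on a punctured line over `F = 0, H ≠ 0`.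
-/
theorem HasStrata.parallel (h : HasStrata P α x z) :
    HasStrata (parallelPair P) (torusClass K * α + (torusClass K + 1) * z)
      (torusClass K * (x + z) - x) x where
  fst := h.linear
  mul := by
    -- With the factor `s` pulled out, the locus is that of a polynomial linear in `s` minus its
    -- slice `s = 0`.
    have h₁ : (parallelPair P).1 * (parallelPair P).2 = X none * (MvPolynomial.rename some P.2 *
        (X none * MvPolynomial.rename some P.1 + MvPolynomial.rename some P.2)) := by
      simp only [parallelPair]
      ring
    have h₂ : principalClass K (P.2 * P.1 * P.2) = x := by
      rw [principalClass_mul_self, mul_comm, h.mul]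
    rw [h₁, principalClass_option_X_mul, principalClass_option_linear, principalClass_self_mul, h₂]
    simp only [map_mul, map_add, aeval_option_elim_rename_some, aeval_X, Option.elim_none,
      zero_mul, zero_add]
    rw [principalClass_self_mul, mul_comm P.2, h.mul, h.snd]
    ring
  snd := by
    rw [parallelPair, principalClass_option_X_mul]
    simp only [aeval_option_elim_rename_some]
    rw [principalClass_rename_some, h.snd]
    ring

end Pencil

/-! ### Spanning trees of directed multigraphs -/

namespace DirectedMultigraph

variable {V E : Type}

/-- The colouring `c` is constant along each edge in `T`. -/
def IsInvariant (G : DirectedMultigraph V E) (T : Set E) (c : V → Prop) : Prop :=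
  ∀ f ∈ T, (c (G.src f) ↔ c (G.tgt f))

/-- Spanning trees in terms of colourings of the vertices: each invariant colouring is constant,
and each edge is separated by a colouring that is constant along the other edges. -/
def IsTree (G : DirectedMultigraph V E) (T : Set E) : Prop :=
  (∀ c, G.IsInvariant T c → ∀ x y, c x → c y) ∧
    ∀ f ∈ T, ∃ c, G.IsInvariant (T \ {f}) c ∧ ¬ (c (G.src f) ↔ c (G.tgt f))

open scoped Classical in
/-- The Kirchhoff--Symanzik polynomial of a directed multigraph. -/
def treePolynomial (K : Type u) [Field K] (G : DirectedMultigraph V E) [Finite E] :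
    MvPolynomial E K :=
  letI := Fintype.ofFinite E
  ∑ T : Finset E, if G.IsTree ↑T then ∏ e ∈ Finset.univ \ T, MvPolynomial.X e else 0

open scoped Classical in
theorem treePolynomial_eq (K : Type u) [Field K] (G : DirectedMultigraph V E) [Fintype E]
    [DecidableEq E] :
    G.treePolynomial K =
      ∑ T : Finset E, if G.IsTree ↑T then ∏ e ∈ Finset.univ \ T, MvPolynomial.X e else 0 := by
  rw [treePolynomial, Subsingleton.elim (Fintype.ofFinite E) ‹_›]
  congr!

/-! ### Spanning trees and Kirchhoff polynomials under graph isomorphism -/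

section Isomorphism

variable {α β : Type} {G : DirectedMultigraph V E} {H : Graph α β} {p : V → α} {ε : E ≃ E(H)}

theorem exists_equiv_of_isIsomorphic (h : G.toGraph.IsIsomorphic H) :
    ∃ (p : V → α) (ε : E ≃ E(H)), Function.Injective p ∧ (∀ x, x ∈ V(H) ↔ ∃ v, p v = x) ∧
      ∀ f x y, H.IsLink (ε f) x y ↔
        (p (G.src f) = x ∧ p (G.tgt f) = y) ∨ (p (G.src f) = y ∧ p (G.tgt f) = x) := by
  obtain ⟨φ, ψ, h⟩ := h
  refine ⟨fun v => φ ⟨v, trivial⟩, (Equiv.Set.univ E).symm.trans ψ,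
    fun v w hvw => congrArg Subtype.val (φ.injective (Subtype.ext hvw)),
    fun x => ⟨fun hx => ?_, ?_⟩, ?_⟩
  · exact ⟨(φ.symm ⟨x, hx⟩).1, congrArg Subtype.val (φ.apply_symm_apply ⟨x, hx⟩)⟩
  · rintro ⟨v, rfl⟩
    exact (φ _).2
  · intro f x y
    have key := fun v w => h ⟨f, trivial⟩ ⟨v, trivial⟩ ⟨w, trivial⟩
    constructor
    · intro hl
      have hx := hl.left_mem
      have hy := hl.right_mem
      have hφx := congrArg Subtype.val (φ.apply_symm_apply ⟨x, hx⟩)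
      have hφy := congrArg Subtype.val (φ.apply_symm_apply ⟨y, hy⟩)
      have := (h ⟨f, trivial⟩ (φ.symm ⟨x, hx⟩) (φ.symm ⟨y, hy⟩)).2 (by rw [hφx, hφy]; exact hl)
      refine this.imp (fun h => ⟨?_, ?_⟩) (fun h => ⟨?_, ?_⟩)
      · exact .trans (congrArg (fun v => (φ v : α)) (Subtype.ext h.1)) hφx
      · exact .trans (congrArg (fun v => (φ v : α)) (Subtype.ext h.2)) hφy
      · exact .trans (congrArg (fun v => (φ v : α)) (Subtype.ext h.1)) hφy
      · exact .trans (congrArg (fun v => (φ v : α)) (Subtype.ext h.2)) hφx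
    · rintro (⟨rfl, rfl⟩ | ⟨rfl, rfl⟩)
      · exact (key _ _).1 (Or.inl ⟨rfl, rfl⟩)
      · exact (key _ _).1 (Or.inr ⟨rfl, rfl⟩)

/-- An invariant colouring propagates along paths; conversely, being reachable from `v` is itself an
invariant colouring. -/
theorem joinedBy_iff
    (hε : ∀ f x y, H.IsLink (ε f) x y ↔
      (p (G.src f) = x ∧ p (G.tgt f) = y) ∨ (p (G.src f) = y ∧ p (G.tgt f) = x))
    (hp : Function.Injective p) (T : Set E(H)) (v w : V) :
    H.JoinedBy T (p v) (p w) ↔ ∀ c, G.IsInvariant (ε ⁻¹' T) c → c v → c w := by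
  constructor
  · intro h c hc hv
    have key : ∀ x, H.JoinedBy T (p v) x → ∃ u, p u = x ∧ c u := by
      intro x hx
      induction hx with
      | refl => exact ⟨v, rfl, hv⟩
      | tail _ hl ih =>
        obtain ⟨u, rfl, hu⟩ := ih
        obtain ⟨e, he, hl⟩ := hl
        obtain ⟨f, rfl⟩ := ε.surjective e
        rcases (hε f _ _).1 hl with ⟨h₁, h₂⟩ | ⟨h₁, h₂⟩
        · exact ⟨_, h₂, (hc f he).1 (by rwa [hp h₁])⟩
        · exact ⟨_, h₁, (hc f he).2 (by rwa [hp h₂])⟩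
    obtain ⟨u, hu, hcu⟩ := key _ h
    rwa [← hp hu]
  · intro h
    refine h (fun u => H.JoinedBy T (p v) (p u)) (fun f hf => ⟨fun hs => ?_, fun ht => ?_⟩) .refl
    · exact hs.tail ⟨ε f, hf, (hε f _ _).2 (Or.inl ⟨rfl, rfl⟩)⟩
    · exact ht.tail ⟨ε f, hf, (hε f _ _).2 (Or.inr ⟨rfl, rfl⟩)⟩

theorem isSpanningTree_iff (hV : ∀ x, x ∈ V(H) ↔ ∃ v, p v = x)
    (hε : ∀ f x y, H.IsLink (ε f) x y ↔
      (p (G.src f) = x ∧ p (G.tgt f) = y) ∨ (p (G.src f) = y ∧ p (G.tgt f) = x))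
    (hp : Function.Injective p) (T : Set E(H)) :
    H.IsSpanningTree T ↔ G.IsTree (ε ⁻¹' T) := by
  refine and_congr ⟨fun h c hc x y => ?_, fun h x hx y hy => ?_⟩
    ⟨fun h f hf => ?_, fun h e he x y hl hj => ?_⟩
  · exact (joinedBy_iff hε hp T x y).1 (h _ ((hV _).2 ⟨x, rfl⟩) _ ((hV _).2 ⟨y, rfl⟩)) c hc
  · obtain ⟨v, rfl⟩ := (hV x).1 hx
    obtain ⟨w, rfl⟩ := (hV y).1 hy
    exact (joinedBy_iff hε hp T v w).2 fun c hc => h c hc v w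
  · have := h (ε f) hf _ _ ((hε f _ _).2 (Or.inl ⟨rfl, rfl⟩))
    rw [joinedBy_iff hε hp] at this
    push Not at this
    obtain ⟨c, hc, h₁, h₂⟩ := this
    exact ⟨c, fun g hg => hc g ⟨hg.1, fun h => hg.2 (ε.injective h)⟩, fun h => h₂ (h.1 h₁)⟩
  · obtain ⟨f, rfl⟩ := ε.surjective e
    obtain ⟨c, hc, hcf⟩ := h f he
    have hc' : G.IsInvariant (ε ⁻¹' (T \ {ε f})) c :=
      fun g hg => hc g ⟨hg.1, fun h => hg.2 (congrArg ε h)⟩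
    -- The separating colouring may be true at either end, while `joinedBy_iff` only transports
    -- truth one way; the complementary colouring handles the other case.
    have hc'' : G.IsInvariant (ε ⁻¹' (T \ {ε f})) (fun v => ¬ c v) :=
      fun g hg => not_congr (hc' g hg)
    rcases (hε f _ _).1 hl with ⟨rfl, rfl⟩ | ⟨rfl, rfl⟩ <;>
    · have h₁ := (joinedBy_iff hε hp _ _ _).1 hj _ hc'
      have h₂ := (joinedBy_iff hε hp _ _ _).1 hj _ hc''
      tauto

theorem kirchhoffPolynomial_eq (K : Type u) [Field K] [Finite E] [Fintype E(H)]
    (h : G.toGraph.IsIsomorphic H) :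
    ∃ ε : E ≃ E(H), H.kirchhoffPolynomial K = MvPolynomial.rename ε (G.treePolynomial K) := by
  classical
  obtain ⟨p, ε, hp, hV, hε⟩ := exists_equiv_of_isIsomorphic h
  have := Fintype.ofFinite E
  refine ⟨ε, ?_⟩
  rw [Graph.kirchhoffPolynomial, treePolynomial_eq, Finset.sum_filter, map_sum]
  refine (Fintype.sum_equiv ε.finsetCongr _ _ fun T => ?_).symm
  have h₁ : G.IsTree (T : Set E) ↔ H.IsSpanningTree {e | e ∈ ε.finsetCongr T} := by
    rw [isSpanningTree_iff hV hε hp]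
    exact iff_of_eq (congrArg _ (by ext; simp))
  simp only [← h₁]
  split_ifs
  · rw [map_prod]
    refine Finset.prod_equiv ε (by simp) (by simp)
  · exact map_zero _

end Isomorphism

end DirectedMultigraph

/-! ### Spanning trees of a graph with a bananified edge -/

namespace DirectedMultigraph

/-- A set of edges of a string of bananas with exactly one edge in each banana. -/
def IsFull {r : ℕ} {b : Fin r → ℕ} (C : Finset (Σ i, Fin (b i))) : Prop :=
  ∀ i, ∃ j, ⟨i, j⟩ ∈ C ∧ ∀ k, ⟨i, k⟩ ∈ C → k = j

/-- A set of edges of a string of bananas with no edge in one of the bananas, and exactly one edge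
in each of the others. -/
def IsCut {r : ℕ} {b : Fin r → ℕ} (C : Finset (Σ i, Fin (b i))) : Prop :=
  ∃ i, (∀ j, ⟨i, j⟩ ∉ C) ∧ ∀ i', i' ≠ i → ∃ j, ⟨i', j⟩ ∈ C ∧ ∀ k, ⟨i', k⟩ ∈ C → k = j

instance {r : ℕ} {b : Fin r → ℕ} : DecidablePred (IsFull (b := b)) := fun _ =>
  inferInstanceAs (Decidable (∀ _, _))

instance {r : ℕ} {b : Fin r → ℕ} : DecidablePred (IsCut (b := b)) := fun _ =>
  inferInstanceAs (Decidable (∃ _, _))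

theorem iff_of_forall_succ_iff {d : ℕ → Prop} {m n : ℕ} (hmn : m ≤ n)
    (h : ∀ i, m ≤ i → i < n → (d i ↔ d (i + 1))) : d m ↔ d n := by
  induction n, hmn using Nat.le_induction with
  | base => rfl
  | succ n hmn ih =>
    exact (ih fun i h₁ h₂ => h i h₁ (h₂.trans n.lt_succ_self)).trans (h n hmn n.lt_succ_self)

variable {V E : Type} (G : DirectedMultigraph V E) (e : E) (b : List ℕ)

/-- The colouring of the vertices of the bananified graph that is given by a colouring of the
old vertices and the colours of the vertices on the string. -/
def extendColouring (c : V → Prop) (d : ℕ → Prop) : V ⊕ Fin (b.length - 1) → Prop :=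
  Sum.elim c (fun k => d (k + 1))

variable {G e b}

theorem extendColouring_stringVertex {c : V → Prop} {d : ℕ → Prop} (hs : d 0 ↔ c (G.src e))
    (ht : d b.length ↔ c (G.tgt e)) {i : ℕ} (hi : i ≤ b.length) :
    extendColouring b c d (G.stringVertex e b.length i) ↔ d i := by
  rw [stringVertex]
  split_ifs with h₁ h₂
  · rw [h₁]; exact hs.symm
  · have : i - 1 + 1 = i := by omega
    simp [extendColouring, this]
  · have : i = b.length := by omega
    rw [this]; exact ht.symm

theorem stringVertex_zero : G.stringVertex e b.length 0 = .inl (G.src e) := if_pos rfl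

theorem stringVertex_length (hb : b ≠ []) :
    G.stringVertex e b.length b.length = .inl (G.tgt e) := by
  have := List.length_pos_iff.2 hb
  rw [stringVertex, if_neg (by omega), dif_neg (by omega)]

theorem inr_eq_stringVertex (k : Fin (b.length - 1)) :
    .inr k = G.stringVertex e b.length (k + 1) := by
  rw [stringVertex, if_neg (by omega), dif_pos (by simp)]
  simp

variable {T : Set {f : E // f ≠ e}} {C : Set (Σ i : Fin b.length, Fin (b.get i))}

theorem isInvariant_insert_iff {S : Set E} {c : V → Prop} :
    G.IsInvariant (insert e S) c ↔ (c (G.src e) ↔ c (G.tgt e)) ∧ G.IsInvariant S c :=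
  Set.forall_mem_insert

/-- The edges in `T` together with the edges `C` of the string. -/
def joinEdges (T : Set {f : E // f ≠ e}) (C : Set (Σ i : Fin b.length, Fin (b.get i))) :
    Set ({f : E // f ≠ e} ⊕ (Σ i : Fin b.length, Fin (b.get i))) :=
  Sum.inl '' T ∪ Sum.inr '' C

theorem inl_mem_joinEdges {f : {f : E // f ≠ e}} : .inl f ∈ joinEdges T C ↔ f ∈ T := by
  simp [joinEdges]

theorem inr_mem_joinEdges {x : Σ i : Fin b.length, Fin (b.get i)} :
    .inr x ∈ joinEdges T C ↔ x ∈ C := by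
  simp [joinEdges]

theorem isInvariant_joinEdges_iff {c : V ⊕ Fin (b.length - 1) → Prop} :
    (G.bananify e b).IsInvariant (joinEdges T C) c ↔
      G.IsInvariant (Subtype.val '' T) (fun v => c (.inl v)) ∧
      ∀ (i : Fin b.length) (j : Fin (b.get i)), ⟨i, j⟩ ∈ C →
        (c (G.stringVertex e b.length i) ↔ c (G.stringVertex e b.length (i + 1))) := by
  constructor
  · intro h
    refine ⟨?_, fun i j hij => h (.inr ⟨i, j⟩) (inr_mem_joinEdges.2 hij)⟩
    rintro _ ⟨f, hf, rfl⟩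
    exact h (.inl f) (inl_mem_joinEdges.2 hf)
  · rintro ⟨h₁, h₂⟩ (f | ⟨i, j⟩) h
    · exact h₁ _ ⟨f, inl_mem_joinEdges.1 h, rfl⟩
    · exact h₂ i j (inr_mem_joinEdges.1 h)

theorem isInvariant_extendColouring {c : V → Prop} {d : ℕ → Prop} (hs : d 0 ↔ c (G.src e))
    (ht : d b.length ↔ c (G.tgt e)) (h₁ : G.IsInvariant (Subtype.val '' T) c)
    (h₂ : ∀ (i : Fin b.length) (j : Fin (b.get i)), ⟨i, j⟩ ∈ C → (d i ↔ d (i + 1))) :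
    (G.bananify e b).IsInvariant (joinEdges T C) (extendColouring b c d) := by
  refine isInvariant_joinEdges_iff.2 ⟨h₁, fun i j h => ?_⟩
  rw [extendColouring_stringVertex hs ht i.2.le, extendColouring_stringVertex hs ht i.2]
  exact h₂ i j h

theorem joinEdges_sdiff_inl (f : {f : E // f ≠ e}) :
    joinEdges T C \ {.inl f} = joinEdges (T \ {f}) C := by
  ext (g | g) <;> simp [joinEdges]

theorem joinEdges_sdiff_inr (x : Σ i : Fin b.length, Fin (b.get i)) :
    joinEdges T C \ {.inr x} = joinEdges T (C \ {x}) := by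
  ext (g | g) <;> simp [joinEdges]

theorem image_val_sdiff (f : {f : E // f ≠ e}) :
    Subtype.val '' (T \ {f}) = (Subtype.val '' T) \ {(f : E)} := by
  rw [Set.image_sdiff Subtype.val_injective, Set.image_singleton]

theorem insert_image_val_sdiff (f : {f : E // f ≠ e}) :
    insert e (Subtype.val '' T) \ {(f : E)} = insert e (Subtype.val '' (T \ {f})) := by
  rw [image_val_sdiff, Set.insert_sdiff_of_notMem]
  exact fun h => f.2 h.symm

theorem insert_image_val_sdiff_self : insert e (Subtype.val '' T) \ {e} = Subtype.val '' T := by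
  rw [Set.insert_sdiff_of_mem _ (Set.mem_singleton e), Set.sdiff_singleton_eq_self]
  rintro ⟨f, _, hf⟩
  exact f.2 hf

variable {C : Finset (Σ i : Fin b.length, Fin (b.get i))}

/-- If the string connects each of its vertices to one of its ends, and the ends have the same
colour, then a colouring that is constant on the old vertices is constant. -/
theorem constant_of_forall {c : V ⊕ Fin (b.length - 1) → Prop}
    (h : ∀ v w, c (.inl v) → c (.inl w))
    (h' : ∀ i ≤ b.length, c (G.stringVertex e b.length i) ↔ c (.inl (G.src e))) (x y) :
    c x → c y := by
  have key : ∀ z, c z ↔ c (.inl (G.src e)) := by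
    rintro (v | k)
    · exact ⟨h _ _, h _ _⟩
    · rw [inr_eq_stringVertex (G := G) (e := e)]
      exact h' _ (by omega)
  exact fun hx => (key y).2 ((key x).1 hx)

/-- A full string is a path between the ends of `e`, so it plays the role of `e`. -/
theorem isTree_joinEdges_of_isFull (hb : b ≠ []) (hC : IsFull C)
    (hT : G.IsTree (insert e (Subtype.val '' T))) :
    (G.bananify e b).IsTree (joinEdges T C) := by
  refine ⟨fun c hc => ?_, ?_⟩
  · obtain ⟨h₁, h₂⟩ := isInvariant_joinEdges_iff.1 hc
    have key : ∀ i ≤ b.length, c (.inl (G.src e)) ↔ c (G.stringVertex e b.length i) := by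
      intro i hi
      rw [← stringVertex_zero (G := G) (e := e) (b := b)]
      refine iff_of_forall_succ_iff (d := fun i => c (G.stringVertex e b.length i)) i.zero_le
        fun k _ hk => ?_
      obtain ⟨j, hj, _⟩ := hC ⟨k, hk.trans_le hi⟩
      exact h₂ _ j hj
    refine constant_of_forall (hT.1 (fun v => c (.inl v)) (isInvariant_insert_iff.2 ⟨?_, h₁⟩))
      fun i hi => (key i hi).symm
    simpa only [stringVertex_length hb] using key b.length le_rfl
  · rintro (f | ⟨i, j⟩) hf
    · have hf := inl_mem_joinEdges.1 hf
      obtain ⟨c, hc, hcf⟩ := hT.2 f (Set.mem_insert_of_mem _ ⟨f, hf, rfl⟩)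
      rw [insert_image_val_sdiff, isInvariant_insert_iff] at hc
      refine ⟨extendColouring b c (fun _ => c (G.src e)), ?_, hcf⟩
      rw [joinEdges_sdiff_inl]
      exact isInvariant_extendColouring Iff.rfl hc.1 hc.2 fun _ _ _ => Iff.rfl
    · have hf := inr_mem_joinEdges.1 hf
      obtain ⟨c, hc, hce⟩ := hT.2 e (Set.mem_insert _ _)
      rw [insert_image_val_sdiff_self] at hc
      have hs : (if 0 ≤ (i : ℕ) then c (G.src e) else c (G.tgt e)) ↔ c (G.src e) := by simp
      have ht : (if b.length ≤ (i : ℕ) then c (G.src e) else c (G.tgt e)) ↔ c (G.tgt e) := by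
        rw [if_neg i.2.not_ge]
      -- A colouring separating the ends of `e` is extended so that its only jump on the string is
      -- at banana `i`, whose one chosen edge has been removed.
      refine ⟨extendColouring b c (fun k => if k ≤ i then c (G.src e) else c (G.tgt e)), ?_, ?_⟩
      · rw [joinEdges_sdiff_inr]
        refine isInvariant_extendColouring hs ht hc fun i' j' h => ?_
        have : (i' : ℕ) ≠ i := by
          intro h'
          obtain rfl := Fin.ext h'
          obtain ⟨k, _, hk⟩ := hC i'
          exact h.2 (by rw [hk j hf, hk j' h.1]; rfl)
        have : (i' : ℕ) ≤ i ↔ (i' : ℕ) + 1 ≤ i := by omega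
        simp only [this]
      · change ¬ (extendColouring b c _ (G.stringVertex e b.length i) ↔
          extendColouring b c _ (G.stringVertex e b.length (i + 1)))
        rw [extendColouring_stringVertex hs ht i.2.le, extendColouring_stringVertex hs ht i.2]
        simpa using hce

/-- A cut string consists of two paths hanging from the ends of `e`; it reaches all the new vertices
but does not join the ends. -/
theorem isTree_joinEdges_of_isCut (hb : b ≠ []) (hC : IsCut C)
    (hT : G.IsTree (Subtype.val '' T)) :
    (G.bananify e b).IsTree (joinEdges T C) := by
  obtain ⟨i₀, h₀, hC⟩ := hC
  refine ⟨fun c hc => ?_, ?_⟩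
  · obtain ⟨h₁, h₂⟩ := isInvariant_joinEdges_iff.1 hc
    have hconst := hT.1 (fun v => c (.inl v)) h₁
    have step : ∀ k (hk : k < b.length), k ≠ i₀ → (c (G.stringVertex e b.length k) ↔
        c (G.stringVertex e b.length (k + 1))) := by
      intro k hk hk'
      obtain ⟨j, hj, _⟩ := hC ⟨k, hk⟩ (fun h => hk' (congrArg Fin.val h))
      exact h₂ _ j hj
    refine constant_of_forall (G := G) (e := e) hconst fun i hi => ?_
    rcases le_or_gt i i₀ with h | h
    · rw [← stringVertex_zero (G := G) (e := e) (b := b)]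
      exact (iff_of_forall_succ_iff (d := fun i => c (G.stringVertex e b.length i)) i.zero_le
        fun k _ hk => step k (by omega) (by omega)).symm
    · have h₃ : c (.inl (G.tgt e)) ↔ c (.inl (G.src e)) := ⟨hconst _ _, hconst _ _⟩
      rw [← h₃, ← stringVertex_length hb]
      exact iff_of_forall_succ_iff (d := fun i => c (G.stringVertex e b.length i)) hi
        fun k _ hk => step k (by omega) (by omega)
  · rintro (f | ⟨i, j⟩) hf
    · have hf := inl_mem_joinEdges.1 hf
      obtain ⟨c, hc, hcf⟩ := hT.2 f ⟨f, hf, rfl⟩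
      rw [← image_val_sdiff] at hc
      -- The ends of `e` may have different colours here; the jump is placed at the empty banana
      -- `i₀`.
      refine ⟨extendColouring b c (fun k => if k ≤ i₀ then c (G.src e) else c (G.tgt e)), ?_, hcf⟩
      rw [joinEdges_sdiff_inl]
      refine isInvariant_extendColouring (by simp) (by rw [if_neg i₀.2.not_ge]) hc fun i j h => ?_
      have : (i : ℕ) ≠ i₀ := by
        intro h'
        obtain rfl := Fin.ext h'
        exact h₀ j h
      have : (i : ℕ) ≤ i₀ ↔ (i : ℕ) + 1 ≤ i₀ := by omega
      simp only [this]
    · have hf := inr_mem_joinEdges.1 hf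
      have hne : i ≠ i₀ := by
        rintro rfl
        exact h₀ j hf
      have hne' : (i : ℕ) ≠ i₀ := fun h => hne (Fin.ext h)
      -- Removing the edge of banana `i` cuts off the string vertices between `i` and `i₀`, in
      -- whichever order these occur; exactly those are coloured false.
      have hs : (¬ (((i : ℕ) < 0 ∧ 0 ≤ (i₀ : ℕ)) ∨ ((i₀ : ℕ) < 0 ∧ 0 ≤ (i : ℕ)))) ↔
          (fun _ : V => True) (G.src e) := by simp
      have ht : (¬ (((i : ℕ) < b.length ∧ b.length ≤ (i₀ : ℕ)) ∨
          ((i₀ : ℕ) < b.length ∧ b.length ≤ (i : ℕ)))) ↔ (fun _ : V => True) (G.tgt e) := by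
        have := i.2
        have := i₀.2
        simp
      refine ⟨extendColouring b (fun _ => True) (fun k => ¬ (((i : ℕ) < k ∧ k ≤ (i₀ : ℕ)) ∨
        ((i₀ : ℕ) < k ∧ k ≤ (i : ℕ)))), ?_, ?_⟩
      · rw [joinEdges_sdiff_inr]
        refine isInvariant_extendColouring hs ht (fun _ _ => Iff.rfl) fun i' j' h => ?_
        have : (i' : ℕ) ≠ i := by
          intro h'
          obtain rfl := Fin.ext h'
          obtain ⟨k, _, hk⟩ := hC i' hne
          exact h.2 (by rw [hk j hf, hk j' h.1]; rfl)
        have : (i' : ℕ) ≠ i₀ := by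
          intro h'
          obtain rfl := Fin.ext h'
          exact h₀ j' h.1
        omega
      · change ¬ (extendColouring b _ _ (G.stringVertex e b.length i) ↔
          extendColouring b _ _ (G.stringVertex e b.length (i + 1)))
        rw [extendColouring_stringVertex hs ht i.2.le,
          extendColouring_stringVertex hs ht i.2]
        omega

/-- Two chosen edges in one banana form a cycle, and two empty bananas isolate the segment of the
string between them. -/
theorem isFull_or_isCut (hC : (G.bananify e b).IsTree (joinEdges T C)) : IsFull C ∨ IsCut C := by
  have huniq : ∀ i j k, ⟨i, j⟩ ∈ C → ⟨i, k⟩ ∈ C → k = j := by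
    intro i j k hj hk
    by_contra hkj
    obtain ⟨c, hc, hcf⟩ := hC.2 (.inr ⟨i, j⟩) (inr_mem_joinEdges.2 hj)
    refine hcf (hc (.inr ⟨i, k⟩) ⟨inr_mem_joinEdges.2 hk, fun h => hkj ?_⟩)
    simpa using h
  have hlt : ∀ i₁ i₂ : Fin b.length, i₁ < i₂ → (∀ j, ⟨i₁, j⟩ ∉ C) → (∀ j, ⟨i₂, j⟩ ∉ C) → False := by
    intro i₁ i₂ h₁₂ h₁ h₂
    have h := i₂.2
    have h₁₂' : (i₁ : ℕ) < i₂ := h₁₂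
    have hs : (¬ ((i₁ : ℕ) < 0 ∧ 0 ≤ (i₂ : ℕ))) ↔ (fun _ : V => True) (G.src e) := by simp
    have ht : (¬ ((i₁ : ℕ) < b.length ∧ b.length ≤ (i₂ : ℕ))) ↔ (fun _ : V => True) (G.tgt e) := by
      simp
    have := hC.1 (extendColouring b (fun _ => True) (fun k => ¬ ((i₁ : ℕ) < k ∧ k ≤ (i₂ : ℕ))))
      (isInvariant_extendColouring hs ht (fun _ _ => Iff.rfl) fun i j hij => ?_)
      (.inl (G.src e)) (G.stringVertex e b.length i₂) trivial
    · rw [extendColouring_stringVertex hs ht h.le] at this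
      omega
    · have : (i : ℕ) ≠ i₁ := by
        intro h'
        obtain rfl := Fin.ext h'
        exact h₁ j hij
      have : (i : ℕ) ≠ i₂ := by
        intro h'
        obtain rfl := Fin.ext h'
        exact h₂ j hij
      omega
  by_cases h : ∃ i, ∀ j, ⟨i, j⟩ ∉ C
  · obtain ⟨i, hi⟩ := h
    refine Or.inr ⟨i, hi, fun i' hi' => ?_⟩
    by_contra! hcon
    have hi'' : ∀ j, ⟨i', j⟩ ∉ C := fun j hj => by
      obtain ⟨k, hk, hkj⟩ := hcon j hj
      exact hkj (huniq i' j k hj hk)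
    rcases lt_or_gt_of_ne hi' with h | h
    · exact hlt _ _ h hi'' hi
    · exact hlt _ _ h hi hi''
  · push Not at h
    refine Or.inl fun i => ?_
    obtain ⟨j, hj⟩ := h i
    exact ⟨j, hj, fun k hk => huniq i j k hj hk⟩

theorem isTree_insert_of_isFull (hb : b ≠ []) (hC : IsFull C)
    (h : (G.bananify e b).IsTree (joinEdges T C)) :
    G.IsTree (insert e (Subtype.val '' T)) := by
  refine ⟨fun c hc x y => ?_, ?_⟩
  · rw [isInvariant_insert_iff] at hc
    exact h.1 _ (isInvariant_extendColouring (d := fun _ => c (G.src e)) Iff.rfl hc.1 hc.2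
      fun _ _ _ => Iff.rfl) (.inl x) (.inl y)
  · rintro f (rfl | ⟨f, hf, rfl⟩)
    · have hpos := List.length_pos_iff.2 hb
      obtain ⟨j, hj, hj'⟩ := hC ⟨0, hpos⟩
      obtain ⟨c, hc, hcj⟩ := h.2 (.inr ⟨⟨0, hpos⟩, j⟩) (inr_mem_joinEdges.2 hj)
      rw [joinEdges_sdiff_inr, isInvariant_joinEdges_iff] at hc
      refine ⟨fun v => c (.inl v), ?_, ?_⟩
      · rw [insert_image_val_sdiff_self]
        exact hc.1
      · change ¬ (c (G.stringVertex f b.length 0) ↔ c (G.stringVertex f b.length 1)) at hcj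
        -- The colouring jumps across the first banana; the other bananas carry the colour from
        -- position `1` to the target, so the ends of the replaced edge are separated.
        have key := iff_of_forall_succ_iff (d := fun i => c (G.stringVertex f b.length i))
          (m := 1) (n := b.length) hpos (fun i h₁ h₂ => by
            obtain ⟨k, hk, _⟩ := hC ⟨i, h₂⟩
            exact hc.2 ⟨i, h₂⟩ k ⟨hk, fun h => by simp at h; omega⟩)
        simp only [stringVertex_length hb] at key
        rwa [key, stringVertex_zero] at hcj
    · obtain ⟨c, hc, hcf⟩ := h.2 (.inl f) (inl_mem_joinEdges.2 hf)
      rw [joinEdges_sdiff_inl, isInvariant_joinEdges_iff] at hc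
      refine ⟨fun v => c (.inl v), ?_, hcf⟩
      rw [insert_image_val_sdiff, isInvariant_insert_iff]
      refine ⟨?_, hc.1⟩
      have key := iff_of_forall_succ_iff (d := fun i => c (G.stringVertex e b.length i))
        (m := 0) (n := b.length) (Nat.zero_le _) (fun i h₁ h₂ => by
          obtain ⟨k, hk, _⟩ := hC ⟨i, h₂⟩
          exact hc.2 ⟨i, h₂⟩ k hk)
      simpa only [stringVertex_length hb, stringVertex_zero] using key

theorem isTree_of_isCut (hC : IsCut C) (h : (G.bananify e b).IsTree (joinEdges T C)) :
    G.IsTree (Subtype.val '' T) := by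
  obtain ⟨i₀, h₀, hC⟩ := hC
  refine ⟨fun c hc x y => ?_, ?_⟩
  · refine h.1 _ (isInvariant_extendColouring
      (d := fun k => if k ≤ i₀ then c (G.src e) else c (G.tgt e)) (by simp)
      (by rw [if_neg i₀.2.not_ge]) hc fun i j hij => ?_) (.inl x) (.inl y)
    have : (i : ℕ) ≠ i₀ := by
      intro h'
      obtain rfl := Fin.ext h'
      exact h₀ j hij
    have : (i : ℕ) ≤ i₀ ↔ (i : ℕ) + 1 ≤ i₀ := by omega
    simp only [this]
  · rintro _ ⟨f, hf, rfl⟩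
    obtain ⟨c, hc, hcf⟩ := h.2 (.inl f) (inl_mem_joinEdges.2 hf)
    rw [joinEdges_sdiff_inl, isInvariant_joinEdges_iff, image_val_sdiff] at hc
    exact ⟨fun v => c (.inl v), hc.1, hcf⟩

/-- The spanning trees of a graph with a bananified edge. -/
theorem isTree_joinEdges_iff (hb : b ≠ []) :
    (G.bananify e b).IsTree (joinEdges T C) ↔
      IsFull C ∧ G.IsTree (insert e (Subtype.val '' T)) ∨
        IsCut C ∧ G.IsTree (Subtype.val '' T) := by
  constructor
  · intro h
    rcases isFull_or_isCut h with hC | hC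
    · exact Or.inl ⟨hC, isTree_insert_of_isFull hb hC h⟩
    · exact Or.inr ⟨hC, isTree_of_isCut hC h⟩
  · rintro (⟨hC, hT⟩ | ⟨hC, hT⟩)
    · exact isTree_joinEdges_of_isFull hb hC hT
    · exact isTree_joinEdges_of_isCut hb hC hT

end DirectedMultigraph

/-! ### Deletion and contraction, and the polynomial of a bananified graph -/

namespace DirectedMultigraph

open MvPolynomial

variable {V E : Type} (K : Type u) [Field K]

open scoped Classical in
/-- The polynomials `F` and `H` such that `t F + H` is the Kirchhoff--Symanzik polynomial, where `t`
is the variable of the edge `e`: the polynomials of the deletion and of the contraction of `e`. -/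
def edgePair (G : DirectedMultigraph V E) (e : E) [Finite E] :
    MvPolynomial {f : E // f ≠ e} K × MvPolynomial {f : E // f ≠ e} K :=
  letI := Fintype.ofFinite {f : E // f ≠ e}
  (∑ T : Finset {f : E // f ≠ e},
      if G.IsTree (Subtype.val '' (T : Set {f : E // f ≠ e})) then
        ∏ f ∈ Finset.univ \ T, X f else 0,
    ∑ T : Finset {f : E // f ≠ e},
      if G.IsTree (insert e (Subtype.val '' (T : Set {f : E // f ≠ e}))) then
        ∏ f ∈ Finset.univ \ T, X f else 0)

/-- The sum of the monomials given by the complements of the sets `C` with the property `p`. -/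
def complementSum {B : Type} [Fintype B] [DecidableEq B] (p : Finset B → Prop) [DecidablePred p] :
    MvPolynomial B K :=
  ∑ C with p C, ∏ f ∈ Finset.univ \ C, X f

variable {K}

theorem treePolynomial_eq_edgePair (G : DirectedMultigraph V E) (e : E) [Finite E] :
    G.treePolynomial K =
      X e * rename Subtype.val (G.edgePair K e).1 + rename Subtype.val (G.edgePair K e).2 := by
  classical
  have := Fintype.ofFinite E
  let _ := Fintype.ofFinite {f : E // f ≠ e}
  rw [treePolynomial_eq]
  have huniv : (Finset.univ : Finset (Finset E)) =
      (insert e (Finset.univ.erase e) : Finset E).powerset := by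
    ext; simp
  rw [huniv, Finset.sum_powerset_insert (Finset.notMem_erase _ _)]
  have key : ∀ φ : Finset E → MvPolynomial E K, ∑ T ∈ (Finset.univ.erase e).powerset, φ T =
      ∑ T : Finset {f : E // f ≠ e}, φ (T.map (.subtype _)) := by
    intro φ
    refine (Finset.sum_bij' (fun T _ => T.map (.subtype _)) (fun T _ => T.subtype _)
      ?_ ?_ ?_ ?_ ?_).symm
    · intro T _
      simp only [Finset.mem_powerset]
      intro f
      simp +contextual
    · simp
    · intro T _
      ext f
      simpa using fun _ => f.2
    · intro T hT
      rw [Finset.subtype_map, Finset.filter_true_of_mem]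
      intro f hf
      exact Finset.ne_of_mem_erase (Finset.mem_powerset.1 hT hf)
    · simp
  rw [key, key, edgePair, map_sum, map_sum, Finset.mul_sum]
  congr 1
  · refine Finset.sum_congr rfl fun T _ => ?_
    have h : Finset.univ \ T.map (.subtype _) = insert e ((Finset.univ \ T).map (.subtype _)) := by
      ext f
      by_cases hf : f = e <;> simp [hf]
    rw [Finset.coe_map, h, apply_ite (rename _), mul_ite, map_zero, mul_zero,
      Finset.prod_insert (by simp), Finset.prod_map, map_prod]
    simp only [rename_X]
    rfl
  · refine Finset.sum_congr rfl fun T _ => ?_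
    have h : Finset.univ \ insert e (T.map (.subtype _)) = (Finset.univ \ T).map (.subtype _) := by
      ext f
      by_cases hf : f = e <;> simp [hf]
    rw [Finset.coe_insert, Finset.coe_map, h, apply_ite (rename _), map_zero,
      Finset.prod_map, map_prod]
    simp only [rename_X]
    rfl

/-- By `isTree_joinEdges_iff`, full sets pair with trees containing `e` and cut sets with trees
avoiding it, so the sum over pairs factors. -/
theorem treePolynomial_bananify (G : DirectedMultigraph V E) (e : E) [Finite E] (b : List ℕ)
    (hb : b ≠ []) :
    (G.bananify e b).treePolynomial K =
      rename Sum.inr (complementSum K (IsCut (b := b.get))) * rename Sum.inl (G.edgePair K e).1 +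
      rename Sum.inr (complementSum K (IsFull (b := b.get))) *
        rename Sum.inl (G.edgePair K e).2 := by
  classical
  let _ := Fintype.ofFinite {f : E // f ≠ e}
  rw [treePolynomial_eq, ← Equiv.sum_comp Finset.sumEquiv.symm.toEquiv, Fintype.sum_prod_type]
  rw [edgePair, complementSum, complementSum]
  simp only [map_sum, Finset.sum_filter, Finset.sum_mul_sum]
  rw [Finset.sum_comm, ← Finset.sum_add_distrib]
  refine Finset.sum_congr rfl fun C _ => ?_
  rw [← Finset.sum_add_distrib]
  refine Finset.sum_congr rfl fun T _ => ?_
  have h₁ : ((Finset.sumEquiv.symm.toEquiv (T, C) : Finset _) : Set _) = 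
      joinEdges (T : Set {f : E // f ≠ e}) (C : Set (Σ i : Fin b.length, Fin (b.get i))) := by
    ext (f | f) <;> simp [joinEdges]
  have h₂ : Finset.univ \ (Finset.sumEquiv.symm.toEquiv (T, C) : Finset _) =
      (Finset.univ \ T).disjSum (Finset.univ \ C) := by
    ext (f | f) <;> simp
  have h₃ : ¬ (IsFull C ∧ IsCut C) := by
    rintro ⟨hf, i, hi, _⟩
    obtain ⟨j, hj, _⟩ := hf i
    exact hi j hj
  rw [h₁, h₂, isTree_joinEdges_iff hb, Finset.prod_disjSum]
  simp only [apply_ite (rename _), map_zero, map_prod, rename_X]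
  by_cases hf : IsFull C <;> by_cases hc : IsCut C
  · exact (h₃ ⟨hf, hc⟩).elim
  all_goals simp [hf, hc, mul_comm]

/-- A polynomial of degree at most one in the variable of `e` is determined by its values at `0` and
`1`. -/
theorem edgePair_eq_of_treePolynomial_eq {G : DirectedMultigraph V E} {e : E} [Finite E]
    {A B : MvPolynomial {f : E // f ≠ e} K}
    (h : G.treePolynomial K = X e * rename Subtype.val A + rename Subtype.val B) :
    G.edgePair K e = (A, B) := by
  classical
  rw [treePolynomial_eq_edgePair G e] at h
  have key : ∀ a : K, C a * (G.edgePair K e).1 + (G.edgePair K e).2 = C a * A + B := by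
    intro a
    have := congrArg (aeval fun f => if hf : f = e then (C a : MvPolynomial {f : E // f ≠ e} K)
      else X ⟨f, hf⟩) h
    simp only [map_add, map_mul, aeval_X, aeval_rename, dite_true] at this
    have hX : ((fun f => if hf : f = e then C a else X ⟨f, hf⟩) ∘ Subtype.val :
        {f : E // f ≠ e} → MvPolynomial {f : E // f ≠ e} K) = X :=
      funext fun f => dif_neg f.2
    simpa only [hX, aeval_X_left_apply] using this
  have h₀ := key 0
  have h₁ := key 1
  simp only [map_zero, zero_mul, zero_add, map_one, one_mul] at h₀ h₁
  rw [h₀] at h₁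
  exact Prod.ext (add_right_cancel h₁) h₀

/-- Reduces the strata of a graph to a polynomial identity: the pair may be computed in any
coordinates `σ` that enumerate the edges other than `e`. -/
theorem hasStrata_edgePair {G : DirectedMultigraph V E} {e : E} [Finite E] {σ : Type} [Finite σ]
    {P : MvPolynomial σ K × MvPolynomial σ K} {α x z : GrothendieckRing K} (hP : HasStrata P α x z)
    (t : σ → E) (ht : Function.Injective t) (hr : ∀ f, f ≠ e ↔ ∃ s, t s = f)
    (h : G.treePolynomial K = X e * rename t P.1 + rename t P.2) :
    HasStrata (G.edgePair K e) α x z := by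
  let ε : σ ≃ {f : E // f ≠ e} := Equiv.ofBijective (fun s => ⟨t s, (hr _).2 ⟨s, rfl⟩⟩)
    ⟨fun s s' hs => ht (congrArg Subtype.val hs), fun f => by
      obtain ⟨s, hs⟩ := (hr f).1 f.2
      exact ⟨s, Subtype.ext hs⟩⟩
  rw [edgePair_eq_of_treePolynomial_eq (A := rename ε P.1) (B := rename ε P.2)]
  · exact hP.rename ε
  · rw [h, rename_rename, rename_rename]
    rfl

end DirectedMultigraph

/-! ### The strings `(4)` and `(1, 3, 1)` as iterated series and parallel operations -/

namespace DirectedMultigraph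

open MvPolynomial

variable {V E : Type} {K : Type u} [Field K]

/-- Indexing by complements makes the monomials explicit, so that each concrete case is a finite
check. -/
theorem complementSum_eq {B : Type} [Fintype B] [DecidableEq B] {p : Finset B → Prop}
    [DecidablePred p] {s : Finset (Finset B)} (h : ∀ D, p (Finset.univ \ D) ↔ D ∈ s) :
    complementSum K p = ∑ D ∈ s, ∏ f ∈ D, X f := by
  have hD : ∀ D : Finset B, Finset.univ \ (Finset.univ \ D) = D := fun D => by ext; simp
  refine Finset.sum_bij' (fun C _ => Finset.univ \ C) (fun D _ => Finset.univ \ D) ?_ ?_ ?_ ?_ ?_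
  · intro C hC
    rw [← h, hD]
    exact (Finset.mem_filter.1 hC).2
  · intro D hD
    exact Finset.mem_filter.2 ⟨Finset.mem_univ _, (h D).2 hD⟩
  all_goals simp [hD]

theorem complementSum_isFull_four :
    complementSum K (IsFull (b := [4].get)) =
      X ⟨0, (0 : Fin 4)⟩ * X ⟨0, (1 : Fin 4)⟩ * X ⟨0, (2 : Fin 4)⟩ +
      X ⟨0, (0 : Fin 4)⟩ * X ⟨0, (1 : Fin 4)⟩ * X ⟨0, (3 : Fin 4)⟩ +
      X ⟨0, (0 : Fin 4)⟩ * X ⟨0, (2 : Fin 4)⟩ * X ⟨0, (3 : Fin 4)⟩ +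
      X ⟨0, (1 : Fin 4)⟩ * X ⟨0, (2 : Fin 4)⟩ * X ⟨0, (3 : Fin 4)⟩ := by
  rw [complementSum_eq (s := {
    {⟨0, (0 : Fin 4)⟩, ⟨0, (1 : Fin 4)⟩, ⟨0, (2 : Fin 4)⟩},
    {⟨0, (0 : Fin 4)⟩, ⟨0, (1 : Fin 4)⟩, ⟨0, (3 : Fin 4)⟩},
    {⟨0, (0 : Fin 4)⟩, ⟨0, (2 : Fin 4)⟩, ⟨0, (3 : Fin 4)⟩},
    {⟨0, (1 : Fin 4)⟩, ⟨0, (2 : Fin 4)⟩, ⟨0, (3 : Fin 4)⟩}}) (by decide)]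
  repeat rw [Finset.sum_insert (by decide)]
  rw [Finset.sum_singleton]
  repeat rw [Finset.prod_insert (by decide)]
  simp only [Finset.prod_singleton]
  ring

theorem complementSum_isCut_four :
    complementSum K (IsCut (b := [4].get)) =
      X ⟨0, (0 : Fin 4)⟩ * X ⟨0, (1 : Fin 4)⟩ * X ⟨0, (2 : Fin 4)⟩ * X ⟨0, (3 : Fin 4)⟩ := by
  rw [complementSum_eq (s := {
    {⟨0, (0 : Fin 4)⟩, ⟨0, (1 : Fin 4)⟩, ⟨0, (2 : Fin 4)⟩, ⟨0, (3 : Fin 4)⟩}}) (by decide)]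
  rw [Finset.sum_singleton]
  repeat rw [Finset.prod_insert (by decide)]
  simp only [Finset.prod_singleton]
  ring

theorem complementSum_isFull_one_three_one :
    complementSum K (IsFull (b := [1, 3, 1].get)) =
      X ⟨1, (0 : Fin 3)⟩ * X ⟨1, (1 : Fin 3)⟩ + X ⟨1, (0 : Fin 3)⟩ * X ⟨1, (2 : Fin 3)⟩ +
      X ⟨1, (1 : Fin 3)⟩ * X ⟨1, (2 : Fin 3)⟩ := by
  rw [complementSum_eq (s := {{⟨1, (0 : Fin 3)⟩, ⟨1, (1 : Fin 3)⟩},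
    {⟨1, (0 : Fin 3)⟩, ⟨1, (2 : Fin 3)⟩}, {⟨1, (1 : Fin 3)⟩, ⟨1, (2 : Fin 3)⟩}}) (by decide)]
  repeat rw [Finset.sum_insert (by decide)]
  rw [Finset.sum_singleton]
  repeat rw [Finset.prod_insert (by decide)]
  simp only [Finset.prod_singleton]
  ring

theorem complementSum_isCut_one_three_one :
    complementSum K (IsCut (b := [1, 3, 1].get)) =
      (X ⟨0, (0 : Fin 1)⟩ + X ⟨2, (0 : Fin 1)⟩) *
        (X ⟨1, (0 : Fin 3)⟩ * X ⟨1, (1 : Fin 3)⟩ + X ⟨1, (0 : Fin 3)⟩ * X ⟨1, (2 : Fin 3)⟩ +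
          X ⟨1, (1 : Fin 3)⟩ * X ⟨1, (2 : Fin 3)⟩) +
      X ⟨1, (0 : Fin 3)⟩ * X ⟨1, (1 : Fin 3)⟩ * X ⟨1, (2 : Fin 3)⟩ := by
  rw [complementSum_eq (s := {
    {⟨0, (0 : Fin 1)⟩, ⟨1, (0 : Fin 3)⟩, ⟨1, (1 : Fin 3)⟩},
    {⟨0, (0 : Fin 1)⟩, ⟨1, (0 : Fin 3)⟩, ⟨1, (2 : Fin 3)⟩},
    {⟨0, (0 : Fin 1)⟩, ⟨1, (1 : Fin 3)⟩, ⟨1, (2 : Fin 3)⟩},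
    {⟨2, (0 : Fin 1)⟩, ⟨1, (0 : Fin 3)⟩, ⟨1, (1 : Fin 3)⟩},
    {⟨2, (0 : Fin 1)⟩, ⟨1, (0 : Fin 3)⟩, ⟨1, (2 : Fin 3)⟩},
    {⟨2, (0 : Fin 1)⟩, ⟨1, (1 : Fin 3)⟩, ⟨1, (2 : Fin 3)⟩},
    {⟨1, (0 : Fin 3)⟩, ⟨1, (1 : Fin 3)⟩, ⟨1, (2 : Fin 3)⟩}}) (by decide)]
  repeat rw [Finset.sum_insert (by decide)]
  rw [Finset.sum_singleton]
  repeat rw [Finset.prod_insert (by decide)]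
  simp only [Finset.prod_singleton]
  ring

/-- The edges of a graph with an edge replaced by a `4`-banana, other than the edge `j` of that
banana. -/
def fourEdges {σ : Type} (j : Fin 4) : Option (Option (Option σ)) →
    σ ⊕ (Σ i : Fin [4].length, Fin ([4].get i))
  | none => .inr ⟨0, (j + 1 : Fin 4)⟩
  | some none => .inr ⟨0, (j + 2 : Fin 4)⟩
  | some (some none) => .inr ⟨0, (j + 3 : Fin 4)⟩
  | some (some (some f)) => .inl f

/-- The edges of a graph with an edge replaced by bananas with `1`, `3` and `1` edges, other than
the edge `j` of the `3`-banana. -/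
def oneThreeOneEdges {σ : Type} (j : Fin 3) : Option (Option (Option (Option σ))) →
    σ ⊕ (Σ i : Fin [1, 3, 1].length, Fin ([1, 3, 1].get i))
  | none => .inr ⟨1, (j + 1 : Fin 3)⟩
  | some none => .inr ⟨1, (j + 2 : Fin 3)⟩
  | some (some none) => .inr ⟨0, (0 : Fin 1)⟩
  | some (some (some none)) => .inr ⟨2, (0 : Fin 1)⟩
  | some (some (some (some f))) => .inl f

/-- The first step of the construction: a single edge becomes a `4`-banana. -/
theorem hasStrata_bananify_four {G : DirectedMultigraph V E} {e : E} [Finite E]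
    (h : HasStrata (G.edgePair K e) 0 0 1) (j : Fin 4) :
    ∃ x, HasStrata ((G.bananify e [4]).edgePair K (.inr ⟨0, j⟩))
      ((torusClass K + 1) ^ 2 * torusClass K) x (torusClass K ^ 2 - torusClass K) := by
  -- A `4`-banana arises by doubling an edge three times; the variable left over belongs to the edge
  -- `j`, which can be any of the four by symmetry.
  have h' := h.parallel.parallel.parallel
  refine ⟨_, hasStrata_edgePair (t := fourEdges j) (P := _) (x := _)
    (by convert h' using 1 <;> ring) ?_ ?_ ?_⟩
  · rintro (_ | _ | _ | f) (_ | _ | _ | g) <;> simp [fourEdges]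
  · rintro (f | ⟨i, k⟩)
    · simpa [fourEdges] using ⟨some (some (some f)), rfl⟩
    · have hi : i = ⟨0, by simp⟩ := by ext; have := i.2; simp at this ⊢
      subst hi
      have key : ∀ j k : Fin 4, k ≠ j ↔ j + 1 = k ∨ j + 2 = k ∨ j + 3 = k := by decide
      simpa [Option.exists, fourEdges] using key j k
  · rw [treePolynomial_bananify _ _ _ (by simp), complementSum_isCut_four,
      complementSum_isFull_four]
    simp only [parallelPair, map_add, map_mul, rename_rename, rename_X,
      Function.comp_def, fourEdges]
    fin_cases j <;> simp <;> ring

/-- The further steps of the construction: an edge is replaced by bananas with `1`, `3` and `1`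
edges. -/
theorem hasStrata_bananify_one_three_one {G : DirectedMultigraph V E} {e : E} [Finite E]
    {α x z : GrothendieckRing K} (h : HasStrata (G.edgePair K e) α x z) (j : Fin 3) :
    ∃ x', HasStrata ((G.bananify e [1, 3, 1]).edgePair K (.inr ⟨1, j⟩))
      (torusClass K * (torusClass K + 1) ^ 3 * (α + z)) x'
      ((torusClass K + 1) * torusClass K * ((torusClass K - 1) * α + (torusClass K + 1) * z)) := by
  -- Two splittings give a path of three edges, whose middle edge is then tripled. The first
  -- splitting discards the old `x`.
  have h' := h.series.series.parallel.parallel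
  refine ⟨_, hasStrata_edgePair (t := oneThreeOneEdges j) (P := _) (x := _)
    (by convert h' using 1 <;> ring) ?_ ?_ ?_⟩
  · rintro (_ | _ | _ | _ | f) (_ | _ | _ | _ | g) <;> simp [oneThreeOneEdges]
  · rintro (f | ⟨i, k⟩)
    · simpa [oneThreeOneEdges] using ⟨some (some (some (some f))), rfl⟩
    · have key : ∀ j k : Fin 3, k ≠ j ↔ j + 1 = k ∨ j + 2 = k := by decide
      rcases i with ⟨_ | _ | _ | n, hi⟩
      · simpa [Option.exists, oneThreeOneEdges] using
          (Subsingleton.elim (0 : Fin 1) k : (0 : Fin 1) = k)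
      · simpa [Option.exists, oneThreeOneEdges] using key j k
      · simpa [Option.exists, oneThreeOneEdges] using
          (Subsingleton.elim (0 : Fin 1) k : (0 : Fin 1) = k)
      · simp only [List.length_cons, List.length_nil] at hi
        omega
  · rw [treePolynomial_bananify _ _ _ (by simp), complementSum_isCut_one_three_one,
      complementSum_isFull_one_three_one]
    simp only [seriesPair, parallelPair, map_add, map_mul, rename_rename, rename_X,
      Function.comp_def, oneThreeOneEdges]
    fin_cases j <;> simp <;> ring

end DirectedMultigraph

/-! ### The classes of the vacuum chains -/

namespace DirectedMultigraph

open MvPolynomial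

variable {K : Type u} [Field K]

theorem treePolynomial_singleEdge : singleEdge.treePolynomial K = 1 := by
  classical
  have huniv : (Finset.univ : Finset (Finset Unit)) = {∅, {()}} := by decide
  have h₁ : ¬ singleEdge.IsTree ((∅ : Finset Unit) : Set Unit) := fun h => by
    simpa using h.1 (fun v => v = true) (fun f hf => by simp at hf) true false rfl
  have h₂ : singleEdge.IsTree (({()} : Finset Unit) : Set Unit) := by
    refine ⟨fun c hc x y => ?_,
      fun f _ => ⟨fun v => v = true, fun g hg => ?_, by simp [singleEdge]⟩⟩
    · have : c false ↔ c true := hc () (by simp)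
      cases x <;> cases y <;> tauto
    · exact (hg.2 (Subsingleton.elim _ _)).elim
  rw [treePolynomial_eq, huniv, Finset.sum_pair (by decide), if_neg h₁, if_pos h₂, zero_add]
  exact Finset.prod_eq_one fun f hf => by simp at hf

/-- The edge is a bridge, so `F = 0`; contracting it leaves one vertex, so `H = 1`, on an affine
space of dimension zero. -/
theorem hasStrata_singleEdge : HasStrata (singleEdge.edgePair K ()) 0 0 1 := by
  have h : HasStrata ((0, 1) : MvPolynomial Empty K × MvPolynomial Empty K) 0 0 1 := by
    refine ⟨principalClass_zero, ?_, ?_⟩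
    · rw [zero_mul, principalClass_zero]
    · rw [principalClass_one, zero_add, affineClass_congr K (isEmptyAlgEquiv K Empty),
        affineClass_self]
  refine hasStrata_edgePair h Empty.elim (fun x => x.elim) (fun f => ?_) ?_
  · simp
  · simp [treePolynomial_singleEdge]

variable (K) in
/-- The effect of replacing an edge by bananas with `1`, `3` and `1` edges on the classes of
`F ≠ 0` and `F = 0, H ≠ 0`, where `t F + H` is the Kirchhoff--Symanzik polynomial. -/
def strataStep (q : GrothendieckRing K × GrothendieckRing K) :
    GrothendieckRing K × GrothendieckRing K :=
  (torusClass K * (torusClass K + 1) ^ 3 * (q.1 + q.2),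
    (torusClass K + 1) * torusClass K * ((torusClass K - 1) * q.1 + (torusClass K + 1) * q.2))

variable {V E : Type}

theorem grothendieckClass_of_isIsomorphic [Finite E] {G : DirectedMultigraph V E} {e : E}
    {a x z : GrothendieckRing K} (h : HasStrata (G.edgePair K e) a x z) {α β : Type} {H : Graph α β}
    [Fintype E(H)] (hH : G.toGraph.IsIsomorphic H) :
    H.grothendieckClass K = torusClass K * a + (torusClass K + 1) * z := by
  classical
  obtain ⟨ε, hε⟩ := kirchhoffPolynomial_eq K hH
  rw [Graph.grothendieckClass, hε, varietyClass_hypersurfaceComplement, principalClass_rename,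
    treePolynomial_eq_edgePair G e, ← h.linear,
    ← principalClass_rename ((Equiv.optionSubtypeNe e).symm)]
  congr 1
  have h₁ : (⇑(Equiv.optionSubtypeNe e).symm ∘ Subtype.val : {f : E // f ≠ e} → _) = some := by
    funext f
    simpa using f.2
  simp [rename_rename, h₁]

/-- The construction may pick any edge with the prescribed label, so the induction carries the
strata of all of them at once. The bound on the stages in the labels keeps older edges from being
mistaken for those of the newest stage. -/
theorem grothendieckClass_of_isConstructedFrom (k : ℕ) (g : ℕ → ℕ) (hg : ∀ i, g (i + 1) = 2)
    {V E : Type} [Finite E] (G : DirectedMultigraph V E) (label : E → ℕ × ℕ) (s : ℕ)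
    (q : GrothendieckRing K × GrothendieckRing K) (hlabel : ∀ f, (label f).1 ≤ s)
    (hex : ∃ f, label f = (s, g 0))
    (hq : ∀ f, label f = (s, g 0) → ∃ x, HasStrata (G.edgePair K f) q.1 x q.2)
    {α β : Type} (H : Graph α β) [Fintype E(H)]
    (h : IsConstructedFrom H ((List.range k).map fun i => ⟨[1, 3, 1], i + s, g i⟩) G label
      (s + 1)) :
    H.grothendieckClass K = torusClass K * ((strataStep K)^[k] q).1 +
      (torusClass K + 1) * ((strataStep K)^[k] q).2 := by
  induction k generalizing g V E G label s q with
  | zero =>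
    obtain ⟨f, hf⟩ := hex
    obtain ⟨x, hx⟩ := hq f hf
    exact grothendieckClass_of_isIsomorphic hx h
  | succ k ih =>
    rw [List.range_succ_eq_map, List.map_cons, List.map_map] at h
    obtain ⟨-, -, e, he, h⟩ := h
    rw [zero_add] at he
    obtain ⟨x, hx⟩ := hq e he
    rw [Function.iterate_succ_apply]
    refine ih (fun i => g (i + 1)) (fun i => hg _) (G.bananify e [1, 3, 1])
      (Sum.elim (fun f => label f) (fun f => (s + 1, (f.1 : ℕ) + 1))) (s + 1)
      (strataStep K q) ?_ ?_ ?_ ?_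
    · rintro (f | f)
      · exact (hlabel f).trans s.le_succ
      · exact le_rfl
    · exact ⟨.inr ⟨1, (0 : Fin 3)⟩, by simp [hg]⟩
    · rintro (f | ⟨i, j⟩) hf
      · have := hlabel f
        simp only [Sum.elim_inl] at hf
        rw [hf] at this
        simp at this
      · simp only [Sum.elim_inr, hg, Prod.mk.injEq] at hf
        -- Bananas are numbered from `1`, so index `2` is the `3`-banana at position `1`.
        obtain rfl : i = 1 := Fin.ext (by simpa using hf.2)
        exact hasStrata_bananify_one_three_one hx j
    · convert h using 3
      simp only [Function.comp_apply]
      congr 1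
      omega

theorem exists_isConstructedFrom (k : ℕ) (g : ℕ → ℕ) (hg : ∀ i, g (i + 1) = 2)
    {V E : Type} [Finite E] (G : DirectedMultigraph V E) (label : E → ℕ × ℕ) (s : ℕ)
    (hex : ∃ f, label f = (s, g 0)) :
    ∃ (α β : Type) (H : Graph α β), Finite E(H) ∧
      IsConstructedFrom H ((List.range k).map fun i => ⟨[1, 3, 1], i + s, g i⟩) G label
        (s + 1) := by
  induction k generalizing g V E G label s with
  | zero =>
    exact ⟨V, E, G.toGraph, inferInstance, .refl _, .refl _, fun _ _ _ => Iff.rfl⟩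
  | succ k ih =>
    obtain ⟨e, he⟩ := hex
    obtain ⟨α, β, H, hfin, hH⟩ := ih (fun i => g (i + 1)) (fun i => hg _) (G.bananify e [1, 3, 1])
      (Sum.elim (fun f => label f) (fun f => (s + 1, (f.1 : ℕ) + 1))) (s + 1)
      ⟨.inr ⟨1, (0 : Fin 3)⟩, by simp [hg]⟩
    refine ⟨α, β, H, hfin, ?_⟩
    rw [List.range_succ_eq_map, List.map_cons, List.map_map]
    refine ⟨by simp, by simp, e, by simpa using he, ?_⟩
    convert hH using 3
    simp only [Function.comp_apply]
    congr 1
    omega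

theorem exists_isMelonicGraph_vacuumChain (n : ℕ) :
    ∃ (α β : Type) (H : Graph α β), Finite E(H) ∧ IsMelonicGraph (vacuumChain n) H := by
  obtain ⟨α, β, H, hfin, hH⟩ := exists_isConstructedFrom (n - 2) (fun i => if i = 0 then 1 else 2)
    (by simp) (singleEdge.bananify () [4])
    (Sum.elim (fun _ => (0, 1)) (fun f => (1, (f.1 : ℕ) + 1))) 1
    ⟨.inr ⟨⟨0, by simp⟩, (0 : Fin 4)⟩, by simp⟩
  exact ⟨α, β, H, hfin, by simp, by simp, (), rfl, hH⟩

theorem grothendieckClass_vacuumChain (n : ℕ) {α β : Type} (H : Graph α β) [Fintype E(H)]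
    (h : IsMelonicGraph (vacuumChain n) H) :
    H.grothendieckClass K =
      torusClass K * ((strataStep K)^[n - 2]
        ((torusClass K + 1) ^ 2 * torusClass K, torusClass K ^ 2 - torusClass K)).1 +
      (torusClass K + 1) * ((strataStep K)^[n - 2]
        ((torusClass K + 1) ^ 2 * torusClass K, torusClass K ^ 2 - torusClass K)).2 := by
  obtain ⟨-, -, e, -, h⟩ := h
  refine grothendieckClass_of_isConstructedFrom (n - 2) (fun i => if i = 0 then 1 else 2)
    (by simp) _ _ 1 _ ?_ ?_ ?_ H h
  · rintro (f | f) <;> simp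
  · exact ⟨.inr ⟨⟨0, by simp⟩, (0 : Fin 4)⟩, by simp⟩
  · rintro (f | ⟨i, j⟩) hf
    · simp at hf
    · obtain rfl : i = ⟨0, by simp⟩ := Fin.ext (by simp)
      exact hasStrata_bananify_four hasStrata_singleEdge j

/-- Both sides satisfy the same second-order recurrence, by Cayley–Hamilton for the linear map
`strataStep`, and they agree for `k = 0, 1`. -/
theorem strataStep_iterate_eq (P : ℕ → ℤ[X]) (h₂ : P 2 = .X ^ 2 + 2 * .X - 1)
    (h₁ : P 1 = .X) (hP : ∀ n, P (n + 3) = (2 + .X) * P (n + 2) - 2 * P (n + 1)) (k : ℕ) :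
    torusClass K * ((strataStep K)^[k]
        ((torusClass K + 1) ^ 2 * torusClass K, torusClass K ^ 2 - torusClass K)).1 +
      (torusClass K + 1) * ((strataStep K)^[k]
        ((torusClass K + 1) ^ 2 * torusClass K, torusClass K ^ 2 - torusClass K)).2 =
    torusClass K ^ (k + 1) * (torusClass K + 1) ^ (2 * k + 1) *
      Polynomial.aeval (torusClass K) (P (k + 2)) := by
  induction k using Nat.twoStepInduction with
  | zero =>
    simp [h₂, map_ofNat]
    ring
  | one =>
    simp [hP, h₂, h₁, strataStep, map_ofNat]
    ring
  | more k ih₁ ih₂ =>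
    rw [Function.iterate_succ_apply'] at ih₂
    rw [Function.iterate_succ_apply', Function.iterate_succ_apply', hP (k + 1), map_sub, map_mul,
      map_mul]
    simp only [map_add, Polynomial.aeval_X, map_ofNat]
    generalize (strataStep K)^[k] _ = q at *
    simp only [strataStep] at *
    -- The coefficients are the trace and the determinant of `strataStep`.
    linear_combination (torusClass K * (torusClass K + 1) ^ 2 * (torusClass K + 2)) * ih₂ -
      2 * torusClass K ^ 2 * (torusClass K + 1) ^ 4 * ih₁

end DirectedMultigraph

/-! ### Formal expansions -/

section LinearRecurrence

/-- The sequence with `a₀ = 1`, `a₁ = b` and `aₖ₊₂ = p aₖ₊₁ + q aₖ`. -/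
def recurrentSeq {R : Type*} [CommRing R] (b p q : R) : ℕ → R
  | 0 => 1
  | 1 => b
  | k + 2 => p * recurrentSeq b p q (k + 1) + q * recurrentSeq b p q k

theorem map_recurrentSeq {R S : Type*} [CommRing R] [CommRing S] (φ : R →+* S) (b p q : R) (k : ℕ) :
    φ (recurrentSeq b p q k) = recurrentSeq (φ b) (φ p) (φ q) k := by
  induction k using Nat.twoStepInduction with
  | zero => exact map_one φ
  | one => rfl
  | more k h₁ h₂ => simp only [recurrentSeq, map_add, map_mul, h₁, h₂]

/-! ### Coefficients of `e^{as} cos(bs)` -/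

section ExpCos

open PowerSeries

variable {A : Type*} [CommRing A] [Algebra ℚ A]

omit [Algebra ℚ A] in
theorem derivative_rescale (a : A) (f : A⟦X⟧) :
    derivative A (rescale a f) = C a * rescale a (derivative A f) := by
  ext n
  rw [coeff_derivative, coeff_C_mul, coeff_rescale, coeff_rescale, coeff_derivative]
  ring

omit [Algebra ℚ A] in
theorem constantCoeff_rescale (a : A) (f : A⟦X⟧) :
    constantCoeff (rescale a f) = constantCoeff f := by
  rw [← coeff_zero_eq_constantCoeff_apply, coeff_rescale, pow_zero, one_mul,
    coeff_zero_eq_constantCoeff_apply]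

theorem constantCoeff_sin : constantCoeff (sin A) = 0 := by
  rw [← coeff_zero_eq_constantCoeff_apply, sin, coeff_mk]
  simp

theorem constantCoeff_cos : constantCoeff (cos A) = 1 := by
  rw [← coeff_zero_eq_constantCoeff_apply, cos, coeff_mk]
  simp

theorem algebraMap_div_factorial_succ_mul (x : ℚ) (n : ℕ) :
    algebraMap ℚ A (x / (Nat.factorial (n + 1) : ℕ)) * ((n : A) + 1) =
      algebraMap ℚ A (x / (Nat.factorial n : ℕ)) := by
  have h : ((n : A) + 1) = algebraMap ℚ A (n + 1) := by simp
  rw [h, ← map_mul, Nat.factorial_succ]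
  congr 1
  have : (Nat.factorial n : ℚ) ≠ 0 := by positivity
  have : (n : ℚ) + 1 ≠ 0 := by positivity
  push_cast
  field_simp

theorem derivative_sin : derivative A (sin A) = cos A := by
  ext n
  simp only [coeff_derivative, sin, cos, coeff_mk]
  rcases Nat.even_or_odd' n with ⟨m, rfl | rfl⟩
  · rw [if_neg (by simp), if_pos (by simp), algebraMap_div_factorial_succ_mul,
      show (2 * m + 1) / 2 = 2 * m / 2 by omega]
  · rw [if_pos (by simp [parity_simps]), if_neg (by simp), zero_mul]

theorem derivative_cos : derivative A (cos A) = -sin A := by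
  ext n
  simp only [coeff_derivative, sin, cos, coeff_mk, map_neg]
  rcases Nat.even_or_odd' n with ⟨m, rfl | rfl⟩
  · rw [if_neg (by simp), if_pos (by simp), zero_mul, neg_zero]
  · rw [if_pos (by simp [parity_simps]), if_neg (by simp), algebraMap_div_factorial_succ_mul,
      ← map_neg, ← neg_div]
    have h₁ : (2 * m + 1 + 1) / 2 = m + 1 := by omega
    have h₂ : (2 * m + 1) / 2 = m := by omega
    rw [h₁, h₂, pow_succ, mul_neg_one]

/-- The series solves `F'' = 2 a F' - (a² + b²) F` with `F(0) = 1` and `F'(0) = a`. -/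
theorem coeff_exp_mul_cos (a b : A) (k : ℕ) :
    coeff k (rescale a (exp A) * rescale b (cos A)) =
      ((Nat.factorial k : ℚ)⁻¹) • recurrentSeq a (2 * a) (-(a ^ 2 + b ^ 2)) k := by
  set F := rescale a (exp A) * rescale b (cos A) with hF
  have h₁ : derivative A F = C a * F - C b * (rescale a (exp A) * rescale b (sin A)) := by
    rw [hF, Derivation.leibniz, derivative_rescale, derivative_rescale, derivative_cos,
      derivative_exp]
    simp only [smul_eq_mul, map_neg]
    ring
  have h₂ : derivative A (derivative A F) =
      C (2 * a) * derivative A F + C (-(a ^ 2 + b ^ 2)) * F := by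
    have h₃ : derivative A (rescale a (exp A) * rescale b (sin A)) =
        C a * (rescale a (exp A) * rescale b (sin A)) + C b * F := by
      rw [hF, Derivation.leibniz, derivative_rescale, derivative_rescale, derivative_sin,
        derivative_exp]
      simp only [smul_eq_mul]
      ring
    rw [h₁, map_sub, Derivation.leibniz, Derivation.leibniz _ (C b), h₃, h₁]
    simp only [smul_eq_mul, derivative_C, map_mul, map_add, map_neg, map_pow, map_ofNat]
    ring
  have h₀ : coeff 0 F = 1 := by
    simp [hF, constantCoeff_rescale, constantCoeff_cos]
  have h₁' : coeff 1 F = a := by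
    have := congrArg (coeff 0) h₁
    rw [coeff_derivative, map_sub, coeff_C_mul, coeff_C_mul, h₀] at this
    simpa [constantCoeff_rescale, constantCoeff_sin] using this
  induction k using Nat.twoStepInduction with
  | zero => simp [h₀, recurrentSeq]
  | one => simp [h₁', recurrentSeq]
  | more k ih₁ ih₂ =>
    have h := congrArg (coeff k) h₂
    simp only [coeff_derivative, map_add, coeff_C_mul, ih₁, ih₂] at h
    have hk : (Nat.factorial k : ℚ)⁻¹ = (Nat.factorial (k + 2) : ℚ)⁻¹ * ((k + 1) * (k + 2)) := by
      have : (Nat.factorial k : ℚ) ≠ 0 := by positivity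
      rw [Nat.factorial_succ, Nat.factorial_succ]
      push_cast
      field_simp
      ring
    have hk' : (Nat.factorial (k + 1) : ℚ)⁻¹ = (Nat.factorial (k + 2) : ℚ)⁻¹ * (k + 2) := by
      have : (Nat.factorial (k + 1) : ℚ) ≠ 0 := by positivity
      rw [Nat.factorial_succ (k + 1)]
      push_cast
      field_simp
      ring
    have hu : IsUnit (algebraMap ℚ A ((k + 1) * (k + 2))) :=
      (IsUnit.mk0 _ (by positivity)).map _
    refine hu.mul_left_cancel ?_
    rw [hk, hk'] at h
    simp only [Algebra.smul_def, map_mul, map_add, map_natCast, map_one, map_ofNat, recurrentSeq,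
      Nat.cast_add, Nat.cast_one] at h ⊢
    linear_combination h

end ExpCos

/-! ### Summing a recurrent sequence `r`-adically -/

section Sum

open PowerSeries

variable {R : Type*} [CommRing R] {b p q : R⟦X⟧}

/-- Every two steps of the recurrence gain a factor `r`, so `r ^ ⌈k/2⌉` divides the `k`-th term. -/
theorem coeff_recurrentSeq_eq_zero (hb : X ∣ b) (hp : X ∣ p) (hq : X ∣ q) {n k : ℕ}
    (h : 2 * n < k) : coeff n (recurrentSeq b p q k) = 0 := by
  have key : ∀ k, (X : R⟦X⟧) ^ ((k + 1) / 2) ∣ recurrentSeq b p q k := by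
    intro k
    induction k using Nat.twoStepInduction with
    | zero => simp
    | one => simpa [recurrentSeq] using hb
    | more k h₁ h₂ =>
      have : (k + 2 + 1) / 2 = 1 + (k + 1) / 2 := by omega
      rw [this, pow_add, pow_one]
      exact dvd_add (mul_dvd_mul hp ((pow_dvd_pow _ (by omega)).trans h₂)) (mul_dvd_mul hq h₁)
  exact X_pow_dvd_iff.1 (key k) n (by omega)

/-- The sum of the sequence `recurrentSeq b p q`. -/
def recurrentSum (b p q : R⟦X⟧) : R⟦X⟧ :=
  mk fun n => ∑ k ∈ Finset.range (2 * n + 1), coeff n (recurrentSeq b p q k)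

/-- Multiplying a partial sum by `1 - p - q` telescopes, and the boundary terms tend to zero
`r`-adically. -/
theorem recurrentSum_mul (hb : X ∣ b) (hp : X ∣ p) (hq : X ∣ q) :
    (1 - p - q) * recurrentSum b p q = 1 + b - p := by
  have htel : ∀ N, (1 - p - q) * ∑ k ∈ Finset.range N, recurrentSeq b p q k =
      1 + b - p -
        (recurrentSeq b p q N + recurrentSeq b p q (N + 1) - p * recurrentSeq b p q N) := by
    intro N
    induction N with
    | zero => simp [recurrentSeq]
    | succ N ih =>
      rw [Finset.sum_range_succ, mul_add, ih]
      simp only [recurrentSeq]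
      ring
  have hcoeff : ∀ m N, 2 * m < N → coeff m (recurrentSum b p q) =
      coeff m (∑ k ∈ Finset.range N, recurrentSeq b p q k) := by
    intro m N hN
    rw [recurrentSum, coeff_mk, map_sum]
    refine Finset.sum_subset (by simpa using hN) fun k _ hk => ?_
    exact coeff_recurrentSeq_eq_zero hb hp hq (by simpa using hk)
  ext n
  have h₁ : coeff n ((1 - p - q) * recurrentSum b p q) =
      coeff n ((1 - p - q) * ∑ k ∈ Finset.range (2 * n + 1), recurrentSeq b p q k) := by
    rw [coeff_mul, coeff_mul]
    refine Finset.sum_congr rfl fun x hx => ?_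
    have := Finset.HasAntidiagonal.mem_antidiagonal.1 hx
    rw [hcoeff x.2 (2 * n + 1) (by omega)]
  have h₂ : coeff n (p * recurrentSeq b p q (2 * n + 1)) = 0 := by
    rw [coeff_mul]
    refine Finset.sum_eq_zero fun x hx => ?_
    have := Finset.HasAntidiagonal.mem_antidiagonal.1 hx
    rw [coeff_recurrentSeq_eq_zero hb hp hq (by omega), mul_zero]
  rw [h₁, htel, map_sub, map_sub _ (_ + _) (_ * _), map_add _ (recurrentSeq _ _ _ _), h₂,
    coeff_recurrentSeq_eq_zero hb hp hq (by omega), coeff_recurrentSeq_eq_zero hb hp hq (by omega)]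
  simp

end Sum

end LinearRecurrence

/-! ### The series of the polynomials `Aₙ` and `A'ₙ` -/

namespace TauRing

open PowerSeries

theorem ofIntSeries_injective : Function.Injective ofIntSeries := by
  have h₁ : Function.Injective ofSeries := by
    refine AdjoinRoot.of.injective_of_degree_ne_zero ?_
    rw [Polynomial.degree_X_pow_sub_C (by norm_num)]
    norm_num
  exact h₁.comp (PowerSeries.map_injective _ (Polynomial.map_injective _ Int.cast_injective))

theorem tau_sq : tau ^ 2 = ofSeries (X ^ 2 - X * C Polynomial.X) := by
  have := AdjoinRoot.eval₂_root (Polynomial.X ^ 2 - Polynomial.C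
    (PowerSeries.X ^ 2 - PowerSeries.X * PowerSeries.C Polynomial.X : ℚ[X]⟦X⟧))
  rw [Polynomial.eval₂_sub, Polynomial.eval₂_X_pow, Polynomial.eval₂_C] at this
  exact sub_eq_zero.1 this

/-- The coefficients `aₖ` are determined by `F`, since `ofIntSeries` is injective and factorials are
invertible; hence so are the sums. -/
theorem isSummedExpansion_iff {F : TauRing⟦X⟧} {b p q : ℤ[X]⟦X⟧} (hb : X ∣ b) (hp : X ∣ p)
    (hq : X ∣ q)
    (hF : F = mk fun k => ((Nat.factorial k : ℚ)⁻¹) • ofIntSeries (recurrentSeq b p q k))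
    (P : ℕ → ℤ[X]) :
    IsSummedExpansion F P ↔ P = fun n => coeff n (recurrentSum b p q) := by
  have hsub : ∀ n, {k | coeff n (recurrentSeq b p q k) ≠ 0} ⊆ Finset.range (2 * n + 1) := by
    intro n k hk
    by_contra h
    exact hk (coeff_recurrentSeq_eq_zero hb hp hq (by simpa using h))
  have hsum : ∀ n, ∑ᶠ k, coeff n (recurrentSeq b p q k) = coeff n (recurrentSum b p q) := by
    intro n
    rw [recurrentSum, coeff_mk]
    exact finsum_eq_sum_of_support_subset _ (hsub n)
  constructor
  · rintro ⟨a, ha, h⟩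
    have : a = recurrentSeq b p q := by
      funext k
      rw [hF] at ha
      have hk := congrArg (coeff k) ha
      rw [coeff_mk, coeff_mk] at hk
      have hk := congrArg ((Nat.factorial k : ℚ) • ·) hk
      have hne : (Nat.factorial k : ℚ) ≠ 0 := by positivity
      simp only [smul_smul, mul_inv_cancel₀ hne, one_smul] at hk
      exact (ofIntSeries_injective hk).symm
    funext n
    rw [← (h n).2, this, hsum]
  · rintro rfl
    exact ⟨_, hF, fun n => ⟨(Finset.finite_toSet _).subset (hsub n), hsum n⟩⟩

/-- The power series `τ² = r² - r t` over `ℤ[t]`. -/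
def tauSq : ℤ[X]⟦X⟧ := X ^ 2 - X * C Polynomial.X

theorem ofIntSeries_tauSq : ofIntSeries tauSq = tau ^ 2 := by
  rw [tau_sq, ofIntSeries, tauSq]
  simp

theorem X_dvd_tauSq : X ∣ tauSq := dvd_sub (dvd_pow_self _ two_ne_zero) (dvd_mul_right _ _)

theorem ofIntSeries_X : ofIntSeries X = ofSeries X := by
  simp [ofIntSeries]

/-- The sum of the coefficients of `e^{rs} cos(τ s)`. -/
def expCosSum : ℤ[X]⟦X⟧ := recurrentSum X (2 * X) (-(X ^ 2 + tauSq))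

theorem isSummedExpansion_expCosSeries_iff (P : ℕ → ℤ[X]) :
    IsSummedExpansion expCosSeries P ↔ P = fun n => coeff n expCosSum := by
  refine isSummedExpansion_iff dvd_rfl (dvd_mul_left _ _)
    (dvd_neg.2 (dvd_add (dvd_pow_self _ two_ne_zero) X_dvd_tauSq)) ?_ P
  ext k
  rw [expCosSeries, coeff_exp_mul_cos, coeff_mk, map_recurrentSeq]
  simp only [map_mul, map_neg, map_add, map_pow, map_ofNat, ofIntSeries_X, ofIntSeries_tauSq]

theorem expCosSum_mul :
    (1 - C (2 + Polynomial.X) * X + 2 * X ^ 2) * expCosSum = 1 - X := by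
  have := recurrentSum_mul (b := X) (p := 2 * X) (q := -(X ^ 2 + tauSq)) dvd_rfl (dvd_mul_left _ _)
    (dvd_neg.2 (dvd_add (dvd_pow_self _ two_ne_zero) X_dvd_tauSq))
  rw [← expCosSum, tauSq] at this
  rw [map_add, map_ofNat]
  linear_combination this

/-- The inverse of `1 - r`. -/
def invOneSubX : ℤ[X]⟦X⟧ := invOfUnit (1 - X) 1

theorem one_sub_X_mul_invOneSubX : (1 - X) * invOneSubX = 1 :=
  mul_invOfUnit _ _ (by simp)

theorem ofIntSeries_invOneSubX : ofIntSeries invOneSubX = ofSeries (invOfUnit (1 - X) 1) := by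
  have h₁ : (1 - ofSeries X) * ofIntSeries invOneSubX = 1 := by
    rw [← ofIntSeries_X, ← RingHom.map_one ofIntSeries, ← RingHom.map_sub ofIntSeries,
      ← RingHom.map_mul ofIntSeries, one_sub_X_mul_invOneSubX]
  have h₂ : (1 - ofSeries X) * ofSeries (invOfUnit (1 - X) 1) = 1 := by
    rw [← RingHom.map_one ofSeries, ← RingHom.map_sub ofSeries, ← RingHom.map_mul ofSeries,
      mul_invOfUnit _ _ (by simp)]
  linear_combination ofSeries (invOfUnit (1 - X) 1) * h₁ - ofIntSeries invOneSubX * h₂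

/-- The sum of the coefficients of `cos((τ / (1 - r)) s)`. -/
def cosSum : ℤ[X]⟦X⟧ := recurrentSum 0 0 (-(tauSq * invOneSubX ^ 2))

theorem isSummedExpansion_cosSeries_iff (P : ℕ → ℤ[X]) :
    IsSummedExpansion cosSeries P ↔ P = fun n => coeff n cosSum := by
  refine isSummedExpansion_iff (dvd_zero _) (dvd_zero _)
    (dvd_neg.2 (X_dvd_tauSq.mul_right _)) ?_ P
  ext k
  -- With exponent `0` the exponential factor is `1`, which leaves the cosine alone.
  have := coeff_exp_mul_cos (A := TauRing) 0 (tau * ofSeries (invOfUnit (1 - X) 1)) k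
  rw [rescale_zero_apply, constantCoeff_exp, map_one, one_mul] at this
  rw [cosSeries, this, coeff_mk, map_recurrentSeq]
  simp only [map_mul, map_neg, map_zero, map_pow, mul_zero, ofIntSeries_invOneSubX,
    ofIntSeries_tauSq, mul_pow, zero_pow two_ne_zero, zero_add]

theorem cosSum_mul :
    (1 - C (2 + Polynomial.X) * X + 2 * X ^ 2) * cosSum = (1 - X) ^ 2 := by
  have := recurrentSum_mul (b := 0) (p := 0) (q := -(tauSq * invOneSubX ^ 2)) (dvd_zero _)
    (dvd_zero _) (dvd_neg.2 (X_dvd_tauSq.mul_right _))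
  rw [← cosSum, tauSq] at this
  rw [map_add, map_ofNat]
  have h := one_sub_X_mul_invOneSubX
  -- Clearing the denominator `(1 - r)²` uses `((1 - r) u)² - 1 = ((1 - r) u + 1) ((1 - r) u - 1)`
  -- for `u` the inverse of `1 - r`.
  linear_combination (1 - X) ^ 2 * this -
    (X ^ 2 - X * C Polynomial.X) * cosSum * ((1 - X) * invOneSubX + 1) * h

theorem denominator_ne_zero :
    (1 - C (2 + Polynomial.X) * X + 2 * X ^ 2 : ℤ[X]⟦X⟧) ≠ 0 := by
  intro h
  simpa using congrArg constantCoeff h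

theorem mk_mul_denominator_eq_iff (P : ℕ → ℤ[X]) :
    mk P * (1 - C (2 + Polynomial.X) * X + 2 * X ^ 2) = (1 - X) ^ 2 ↔
      P = fun n => coeff n cosSum := by
  rw [← cosSum_mul, mul_comm, mul_right_inj' denominator_ne_zero]
  constructor
  · intro h
    funext n
    rw [← h, coeff_mk]
  · rintro rfl
    ext n
    rw [coeff_mk]

theorem cosSum_eq : cosSum = (1 - X) * expCosSum := by
  refine mul_left_cancel₀ denominator_ne_zero ?_
  rw [cosSum_mul, mul_left_comm, expCosSum_mul, sq]

theorem coeff_cosSum (n : ℕ) (hn : 1 ≤ n) :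
    coeff n cosSum = coeff n expCosSum - coeff (n - 1) expCosSum := by
  obtain ⟨m, rfl⟩ := Nat.exists_eq_add_of_le' hn
  rw [cosSum_eq, sub_mul, one_mul, map_sub, coeff_succ_X_mul, Nat.add_sub_cancel]

/-- Solved for the leading term, with the powers of `r` in front, so that coefficients can be read
off by shifting. -/
theorem cosSum_eq_add : cosSum = 1 - X * C 2 + X * X + X * (C (2 + Polynomial.X) * cosSum) -
    X * (X * (C 2 * cosSum)) := by
  have := cosSum_mul
  rw [map_ofNat C 2]
  linear_combination this

theorem coeff_cosSum_succ (n : ℕ) : coeff (n + 1) cosSum =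
    coeff (n + 1) (1 - X * C 2 + X * X : ℤ[X]⟦X⟧) + (2 + Polynomial.X) * coeff n cosSum -
      coeff n (X * (C 2 * cosSum)) := by
  conv_lhs => rw [cosSum_eq_add]
  rw [map_sub (coeff _), map_add (coeff _) (1 - X * C 2 + X * X), coeff_succ_X_mul,
    coeff_succ_X_mul, coeff_C_mul]

theorem coeff_cosSum_zero : coeff 0 cosSum = 1 := by
  rw [cosSum_eq_add]
  simp

theorem coeff_cosSum_one : coeff 1 cosSum = Polynomial.X := by
  rw [coeff_cosSum_succ, coeff_cosSum_zero]
  simp [coeff_succ_X_mul (n := 0), coeff_one]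

theorem coeff_cosSum_two : coeff 2 cosSum = Polynomial.X ^ 2 + 2 * Polynomial.X - 1 := by
  rw [coeff_cosSum_succ, coeff_succ_X_mul, coeff_C_mul, coeff_cosSum_zero, coeff_cosSum_one]
  simp [coeff_one, coeff_X]
  ring

/-- The numerator `(1 - r)²` has degree two, so the recurrence is homogeneous from degree three on.
-/
theorem coeff_cosSum_add_three (n : ℕ) : coeff (n + 3) cosSum =
    (2 + Polynomial.X) * coeff (n + 2) cosSum - 2 * coeff (n + 1) cosSum := by
  rw [coeff_cosSum_succ, coeff_succ_X_mul, coeff_C_mul]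
  simp [coeff_one, coeff_X]

end TauRing

end

theorem mainTheorem6 (K : Type u) [Field K] :
    ∃ A A' : ℕ → ℤ[X],
      (∀ P : ℕ → ℤ[X], TauRing.IsSummedExpansion TauRing.expCosSeries P ↔ P = A) ∧
      (∀ P : ℕ → ℤ[X], TauRing.IsSummedExpansion TauRing.cosSeries P ↔ P = A') ∧
      (∀ P : ℕ → ℤ[X],
        PowerSeries.mk P * (1 - PowerSeries.C (2 + Polynomial.X) * PowerSeries.X
          + 2 * PowerSeries.X ^ 2) = (1 - PowerSeries.X) ^ 2 ↔ P = A') ∧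
      (∀ n : ℕ, 1 ≤ n → A' n = A n - A (n - 1)) ∧
      ∀ n : ℕ, 2 ≤ n →
        (∃ (α β : Type) (G : Graph α β), Finite E(G) ∧ IsMelonicGraph (vacuumChain n) G) ∧
        ∀ (α β : Type) (G : Graph α β) [Fintype E(G)], IsMelonicGraph (vacuumChain n) G →
          G.grothendieckClass K =
            torusClass K ^ (n - 1) * (torusClass K + 1) ^ (2 * n - 3) *
              Polynomial.aeval (torusClass K) (A' n) := by
  refine ⟨fun n => PowerSeries.coeff n TauRing.expCosSum,
    fun n => PowerSeries.coeff n TauRing.cosSum, TauRing.isSummedExpansion_expCosSeries_iff,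
    TauRing.isSummedExpansion_cosSeries_iff, TauRing.mk_mul_denominator_eq_iff,
    TauRing.coeff_cosSum, fun n hn =>
      ⟨DirectedMultigraph.exists_isMelonicGraph_vacuumChain n, fun α β G _ hG => ?_⟩⟩
  obtain ⟨k, rfl⟩ := Nat.exists_eq_add_of_le' hn
  rw [DirectedMultigraph.grothendieckClass_vacuumChain _ G hG, Nat.add_sub_cancel]
  exact DirectedMultigraph.strataStep_iterate_eq
    (fun n => PowerSeries.coeff n TauRing.cosSum) TauRing.coeff_cosSum_two
    TauRing.coeff_cosSum_one TauRing.coeff_cosSum_add_three k
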